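/- Let $\omega_1,\omega_2,\omega_3\in\mathbb R$ be pairwise distinct and put $\omega_{ij}=\omega_i-\omega_j$. For $\epsilon\in\mathbb R$ and $x=(m,p)=(m_1,m_2,m_3,p_1,p_2,p_3)\in\mathbb R^6$ let $$M(m,p,\epsilon)=\begin{pmatrix}1&0&0&0&\epsilon\omega_{23}p_3&\epsilon\omega_{23}p_2\\0&1&0&\epsilon\omega_{31}p_3&0&\epsilon\omega_{31}p_1\\0&0&1&\epsilon\omega_{12}p_2&\epsilon\omega_{12}p_1&0\\0&\epsilon p_3&-\epsilon p_2&1&-\epsilon m_3&\epsilon m_2\\-\epsilon p_3&0&\epsilon p_1&\epsilon m_3&1&-\epsilon m_1\\\epsilon p_2&-\epsilon p_1&0&-\epsilon m_2&\epsilon m_1&1\end{pmatrix}$$ and let $f(x)=f(x,\epsilon)=M(x,\epsilon)^{-1}x$ be the discrete Clebsch map, a birational map of $\mathbb R^6$ with $f^{-1}(x,\epsilon)=f(x,-\epsilon)$. Call $x$ regular if its whole orbit $(f^i(x))_{i\in\mathbb Z}$ is defined, that is, $\det M(f^i(x),\epsilon)\neq0$ and $\det M(f^i(x),-\epsilon)\ne0$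 for all $i\in\mathbb Z$. Let $$\Psi=(\psi_1,\dots,\psi_6)=(p_1^2,p_2^2,p_3^2,m_1p_1,m_2p_2,m_3p_3),\qquad K_\Psi(x)=\Big\{c\in\mathbb R^6:\ \sum_{j=1}^6c_j\,\psi_j(f^i(x))=0\ \ \forall i\in\mathbb Z\Big\},$$ $$J=\frac{p_1^2+p_2^2+p_3^2}{1-\epsilon^2(\omega_1p_1^2+\omega_2p_2^2+\omega_3p_3^2)},$$ $$\begin{aligned}d_7^{(2)}&=m_1^2+m_2^2+m_3^2+(\omega_2+\omega_3-2\omega_1)p_1^2+(\omega_3-\omega_2)p_2^2+(\omega_2-\omega_3)p_3^2,\\ d_8^{(2)}&=m_1^2+m_2^2+m_3^2+(\omega_3-\omega_1)p_1^2+(\omega_3+\omega_1-2\omega_2)p_2^2+(\omega_1-\omega_3)p_3^2,\\ d_9^{(2)}&=m_1^2+m_2^2+m_3^2+(\omega_2-\omega_1)p_1^2+(\omega_1-\omega_2)p_2^2+(\omega_1+\omega_2-2\omega_3)p_3^2,\end{aligned}$$ $$\Delta^{(4)}=m_1p_1d_7^{(2)}+m_2p_2d_8^{(2)}+m_3p_3d_9^{(2)}.$$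 **Theorem.** There are homogeneous polynomials $d_k^{(4)},d_k^{(6)}$ ($k=7,8,9$) and $\Delta^{(6)},\Delta^{(8)}$ in $(m,p)$, of the degrees shown by the upper index and independent of $\epsilon$, such that for every real $\epsilon\neq0$ the rational functions, even in $\epsilon$, $$d_k=\frac{(p_1^2+p_2^2+p_3^2)\,(1+\epsilon^2d_k^{(2)}+\epsilon^4d_k^{(4)}+\epsilon^6d_k^{(6)})}{\Delta},\quad \Delta=m_1p_1+m_2p_2+m_3p_3+\epsilon^2\Delta^{(4)}+\epsilon^4\Delta^{(6)}+\epsilon^6\Delta^{(8)},$$ satisfy the following. 1. The regular points are dense in $\mathbb R^6$. The set $\Psi$ is a Hirota–Kimura basis (HK-basis) for $f$: the functions $\psi_1,\dots,\psi_6$ are linearly independent over $\mathbb R$, and $K_\Psi(x)\neq\{0\}$ for every regular $x$. 2. The vector $(-1,-1,-1,d_7(x),d_8(x),d_9(x))$ lies in $K_\Psi(x)$ for every regular $x$ with $\Delta(x)\neq0$. At every regular $x$ outside some proper algebraic subset of $\mathbb R^6$, one has $\Delta(x)\ne0$, $\dim K_\Psi(x)=1$ and $K_\Psi(x)=[-1:-1:-1:d_7(x):d_8(x):d_9(x)]$.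 3. $d_7,d_8,d_9$ are integrals of $f$: $d_k(f(x))=d_k(x)$ wherever both sides are defined. 4. $(\omega_2-\omega_3)d_7+(\omega_3-\omega_1)d_8+(\omega_1-\omega_2)d_9=0$ wherever $\Delta\neq0$. 5. Any two of $d_7,d_8,d_9$ are functionally independent, and any two of them together with $J$ are functionally independent (that is, on a dense open set the functions are differentiable and their differentials are linearly independent). -/

import Mathlib

open MvPolynomial

/-- The phase space `ℝ⁶`. The coordinates `x 0, x 1, x 2` are `m₁, m₂, m₃` and the coordinates
`x 3, x 4, x 5` are `p₁, p₂, p₃`. -/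
abbrev Phase : Type := Fin 6 → ℝ

/-! ### Hirota-Kimura bases, integrals and functional independence -/

/-- The iterates with index `i ∈ ℤ` of a map `f` with inverse `g`: `f` is applied `i` times if
`0 ≤ i`, and `g` is applied `-i` times if `i < 0`. -/
def twoSidedIterate {X : Type*} (f g : X → X) : ℤ → X → X
  | Int.ofNat n => f^[n]
  | Int.negSucc n => g^[n + 1]

theorem twoSidedIterate_add_one {X : Type*} (f g : X → X) (x : X) (i : ℤ)
    (h : ∀ y, y = twoSidedIterate f g (i + 1) x → g y = twoSidedIterate f g i x → f (g y) = y) :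
    twoSidedIterate f g (i + 1) x = f (twoSidedIterate f g i x) := by
  match i with
  | Int.ofNat n => exact Function.iterate_succ_apply' _ _ _
  | Int.negSucc n =>
    have e : twoSidedIterate f g (Int.negSucc n + 1) x = g^[n] x := by
      cases n <;> rfl
    have e2 : twoSidedIterate f g (Int.negSucc n) x = g (g^[n] x) :=
      Function.iterate_succ_apply' _ _ _
    rw [e, e2] at h
    rw [e, e2]
    exact (h _ rfl rfl).symm

/-- The null-space `K_Φ(x)` of a tuple of functions `Φ`, where `F i` is the `i`-th iterate of the
map: all `c` such that `∑ j, c j • Φ j` vanishes along the two-sided orbit of `x`. -/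
def hkNullSpace {X : Type*} {l : ℕ} (F : ℤ → X → X) (Φ : Fin l → X → ℝ) (x : X) :
    Submodule ℝ (Fin l → ℝ) where
  carrier := {c | ∀ i : ℤ, ∑ j, c j * Φ j (F i x) = 0}
  zero_mem' := by intro i; simp
  add_mem' := by
    intro a b ha hb i
    simp only [Pi.add_apply, add_mul, Finset.sum_add_distrib]
    rw [ha i, hb i, add_zero]
  smul_mem' := by
    intro r a ha i
    simp only [Pi.smul_apply, smul_eq_mul, mul_assoc, ← Finset.mul_sum]
    rw [ha i, mul_zero]

/-- `Φ` is a Hirota-Kimura basis for the map with iterates `F i`: its members are linearly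
independent over `ℝ`, and the null-space is nonzero at every point of `D`, the set of points
whose whole two-sided orbit is defined. -/
structure IsHKBasis {X : Type*} {l : ℕ} (F : ℤ → X → X) (D : Set X) (Φ : Fin l → X → ℝ) :
    Prop where
  linearIndependent : LinearIndependent ℝ Φ
  exists_ne_zero : ∀ x ∈ D, ∃ c ∈ hkNullSpace F Φ x, c ≠ 0

/-- A partially defined function `h`, with domain `Dh`, is an integral of a partially defined map
`f`, with domain `Df`: `h (f x) = h x` wherever both sides are defined. -/
def IsIntegralOfMotion {X : Type*} (f : X → X) (Df : Set X) (h : X → ℝ) (Dh : Set X) : Prop :=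
  ∀ x ∈ Df, x ∈ Dh → f x ∈ Dh → h (f x) = h x

/-- Functional independence of finitely many functions on the phase space: on some dense open set
they are differentiable and their differentials are linearly independent at each point. -/
def FunctionallyIndependent {n : ℕ} (g : Fin n → Phase → ℝ) : Prop :=
  ∃ U : Set Phase, IsOpen U ∧ Dense U ∧ ∀ x ∈ U,
    (∀ i, DifferentiableAt ℝ (g i) x) ∧ LinearIndependent ℝ (fun i => fderiv ℝ (g i) x)

/-! ### The discrete Clebsch system -/

/-- The matrix `M(m, p, ε)` of the discrete Clebsch system with parameters
`ω₁ = ω 0, ω₂ = ω 1, ω₃ = ω 2`. -/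
def clebschMatrix (ω : Fin 3 → ℝ) (ε : ℝ) (x : Phase) : Matrix (Fin 6) (Fin 6) ℝ :=
  !![1, 0, 0, 0, ε * (ω 1 - ω 2) * x 5, ε * (ω 1 - ω 2) * x 4;
     0, 1, 0, ε * (ω 2 - ω 0) * x 5, 0, ε * (ω 2 - ω 0) * x 3;
     0, 0, 1, ε * (ω 0 - ω 1) * x 4, ε * (ω 0 - ω 1) * x 3, 0;
     0, ε * x 5, -ε * x 4, 1, -ε * x 2, ε * x 1;
     -ε * x 5, 0, ε * x 3, ε * x 2, 1, -ε * x 0;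
     ε * x 4, -ε * x 3, 0, -ε * x 1, ε * x 0, 1]

/-- The discrete Clebsch map `f(x, ε) = M(x, ε)⁻¹ x`; it is defined where `det M(x, ε) ≠ 0`. -/
noncomputable def clebschMap (ω : Fin 3 → ℝ) (ε : ℝ) (x : Phase) : Phase :=
  Matrix.mulVec (clebschMatrix ω ε x)⁻¹ x

/-- The domain of definition of `f(·, ε)` in the phase space. -/
def clebschDomain (ω : Fin 3 → ℝ) (ε : ℝ) : Set Phase :=
  {x | (clebschMatrix ω ε x).det ≠ 0}

/-- `M(x, ε) y = x` is the implicit, bilinear form of the equations of motion. -/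
theorem clebschMatrix_mulVec_eq_iff (ω : Fin 3 → ℝ) (ε : ℝ) (x y : Phase) :
    Matrix.mulVec (clebschMatrix ω ε x) y = x ↔
      y 0 - x 0 = ε * (ω 2 - ω 1) * (y 4 * x 5 + x 4 * y 5) ∧
      y 1 - x 1 = ε * (ω 0 - ω 2) * (y 5 * x 3 + x 5 * y 3) ∧
      y 2 - x 2 = ε * (ω 1 - ω 0) * (y 3 * x 4 + x 3 * y 4) ∧
      y 3 - x 3 = ε * (y 2 * x 4 + x 2 * y 4) - ε * (y 1 * x 5 + x 1 * y 5) ∧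
      y 4 - x 4 = ε * (y 0 * x 5 + x 0 * y 5) - ε * (y 2 * x 3 + x 2 * y 3) ∧
      y 5 - x 5 = ε * (y 1 * x 3 + x 1 * y 3) - ε * (y 0 * x 4 + x 0 * y 4) := by
  have h : ∀ v w : Phase, v = w ↔
      v 0 = w 0 ∧ v 1 = w 1 ∧ v 2 = w 2 ∧ v 3 = w 3 ∧ v 4 = w 4 ∧ v 5 = w 5 := by
    intro v w
    simp [funext_iff, Fin.forall_fin_succ]
  rw [h]
  simp only [clebschMatrix, Matrix.mulVec, dotProduct, Fin.sum_univ_six, Matrix.of_apply,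
    Matrix.cons_val]
  constructor
  · rintro ⟨h0, h1, h2, h3, h4, h5⟩
    refine ⟨?_, ?_, ?_, ?_, ?_, ?_⟩ <;> linarith
  · rintro ⟨h0, h1, h2, h3, h4, h5⟩
    refine ⟨?_, ?_, ?_, ?_, ?_, ?_⟩ <;> linarith

/-- Reversibility: `f(·, -ε)` inverts `f(·, ε)`. -/
theorem clebschMap_neg_clebschMap (ω : Fin 3 → ℝ) (ε : ℝ) (x : Phase)
    (hx : x ∈ clebschDomain ω ε) (hy : clebschMap ω ε x ∈ clebschDomain ω (-ε)) :
    clebschMap ω (-ε) (clebschMap ω ε x) = x := by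
  have h1 : Matrix.mulVec (clebschMatrix ω ε x) (clebschMap ω ε x) = x := by
    rw [clebschMap, Matrix.mulVec_mulVec, Matrix.mul_nonsing_inv _ (Ne.isUnit hx),
      Matrix.one_mulVec]
  generalize clebschMap ω ε x = y at h1 hy ⊢
  have h2 : Matrix.mulVec (clebschMatrix ω (-ε) y) x = y := by
    rw [clebschMatrix_mulVec_eq_iff] at h1 ⊢
    obtain ⟨h0, h1, h2, h3, h4, h5⟩ := h1
    refine ⟨?_, ?_, ?_, ?_, ?_, ?_⟩ <;> linarith
  calc clebschMap ω (-ε) y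
      = Matrix.mulVec (clebschMatrix ω (-ε) y)⁻¹ (Matrix.mulVec (clebschMatrix ω (-ε) y) x) := by
        rw [h2, clebschMap]
    _ = x := by
        rw [Matrix.mulVec_mulVec, Matrix.nonsing_inv_mul _ (Ne.isUnit hy), Matrix.one_mulVec]

/-- The iterates `f^i`, `i ∈ ℤ`, where `f⁻¹ = f(·, -ε)`. -/
noncomputable def clebschIter (ω : Fin 3 → ℝ) (ε : ℝ) : ℤ → Phase → Phase :=
  twoSidedIterate (clebschMap ω ε) (clebschMap ω (-ε))

/-- The points at which all iterates `f^i`, `i ∈ ℤ`, are defined: each point of the orbit lies in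
the domains of `f = f(·, ε)` and of `f⁻¹ = f(·, -ε)`. -/
def clebschRegular (ω : Fin 3 → ℝ) (ε : ℝ) : Set Phase :=
  {x | ∀ i : ℤ, clebschIter ω ε i x ∈ clebschDomain ω ε ∧
    clebschIter ω ε i x ∈ clebschDomain ω (-ε)}

/-- On regular points `clebschIter` is the two-sided orbit of `clebschMap`. -/
theorem clebschIter_add_one (ω : Fin 3 → ℝ) (ε : ℝ) (x : Phase) (hx : x ∈ clebschRegular ω ε)
    (i : ℤ) : clebschIter ω ε (i + 1) x = clebschMap ω ε (clebschIter ω ε i x) := by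
  refine twoSidedIterate_add_one _ _ x i fun y hy hgy => ?_
  have h1 := hx (i + 1)
  have h2 := hx i
  unfold clebschIter at h1 h2
  rw [← hy] at h1
  rw [← hgy] at h2
  have h3 := clebschMap_neg_clebschMap ω (-ε) y h1.2
  rw [neg_neg] at h3
  exact h3 h2.1

/-! ### The functions `Ψ`, `J`, `d₇`, `d₈`, `d₉` -/

/-- `Ψ = (p₁², p₂², p₃², m₁p₁, m₂p₂, m₃p₃)`. -/
def clebschPsi : Fin 6 → Phase → ℝ :=
  ![fun x => x 3 ^ 2, fun x => x 4 ^ 2, fun x => x 5 ^ 2,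
    fun x => x 0 * x 3, fun x => x 1 * x 4, fun x => x 2 * x 5]

/-- `J = (p₁² + p₂² + p₃²) / (1 - ε² (ω₁p₁² + ω₂p₂² + ω₃p₃²))`. -/
noncomputable def clebschJ (ω : Fin 3 → ℝ) (ε : ℝ) (x : Phase) : ℝ :=
  (x 3 ^ 2 + x 4 ^ 2 + x 5 ^ 2) /
    (1 - ε ^ 2 * (ω 0 * x 3 ^ 2 + ω 1 * x 4 ^ 2 + ω 2 * x 5 ^ 2))

/-- The quadratic polynomials `d₇⁽²⁾, d₈⁽²⁾, d₉⁽²⁾` (in this order). -/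
def clebschD2 (ω : Fin 3 → ℝ) : Fin 3 → Phase → ℝ :=
  ![fun x => x 0 ^ 2 + x 1 ^ 2 + x 2 ^ 2 + (ω 1 + ω 2 - 2 * ω 0) * x 3 ^ 2
      + (ω 2 - ω 1) * x 4 ^ 2 + (ω 1 - ω 2) * x 5 ^ 2,
    fun x => x 0 ^ 2 + x 1 ^ 2 + x 2 ^ 2 + (ω 2 - ω 0) * x 3 ^ 2
      + (ω 2 + ω 0 - 2 * ω 1) * x 4 ^ 2 + (ω 0 - ω 2) * x 5 ^ 2,
    fun x => x 0 ^ 2 + x 1 ^ 2 + x 2 ^ 2 + (ω 1 - ω 0) * x 3 ^ 2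
      + (ω 0 - ω 1) * x 4 ^ 2 + (ω 0 + ω 1 - 2 * ω 2) * x 5 ^ 2]

/-- `Δ⁽⁴⁾ = m₁p₁d₇⁽²⁾ + m₂p₂d₈⁽²⁾ + m₃p₃d₉⁽²⁾`. -/
def clebschDelta4 (ω : Fin 3 → ℝ) (x : Phase) : ℝ :=
  x 0 * x 3 * clebschD2 ω 0 x + x 1 * x 4 * clebschD2 ω 1 x + x 2 * x 5 * clebschD2 ω 2 x

/-- `Δ = m₁p₁ + m₂p₂ + m₃p₃ + ε²Δ⁽⁴⁾ + ε⁴Δ⁽⁶⁾ + ε⁶Δ⁽⁸⁾` for given polynomials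
`Δ⁽⁶⁾ = Δ6`, `Δ⁽⁸⁾ = Δ8`. -/
noncomputable def clebschDelta (ω : Fin 3 → ℝ) (Δ6 Δ8 : MvPolynomial (Fin 6) ℝ) (ε : ℝ)
    (x : Phase) : ℝ :=
  x 0 * x 3 + x 1 * x 4 + x 2 * x 5 + ε ^ 2 * clebschDelta4 ω x
    + ε ^ 4 * eval x Δ6 + ε ^ 6 * eval x Δ8

/-- `d_k = (p₁² + p₂² + p₃²)(1 + ε²d_k⁽²⁾ + ε⁴d_k⁽⁴⁾ + ε⁶d_k⁽⁶⁾) / Δ` for given polynomials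
`d_k⁽⁴⁾ = d4 k`, `d_k⁽⁶⁾ = d6 k`, `Δ⁽⁶⁾ = Δ6`, `Δ⁽⁸⁾ = Δ8`; the indices `k = 0, 1, 2` stand for
`7, 8, 9`. -/
noncomputable def clebschD (ω : Fin 3 → ℝ) (d4 d6 : Fin 3 → MvPolynomial (Fin 6) ℝ)
    (Δ6 Δ8 : MvPolynomial (Fin 6) ℝ) (ε : ℝ) (k : Fin 3) (x : Phase) : ℝ :=
  (x 3 ^ 2 + x 4 ^ 2 + x 5 ^ 2) *
    (1 + ε ^ 2 * clebschD2 ω k x + ε ^ 4 * eval x (d4 k) + ε ^ 6 * eval x (d6 k)) /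
    clebschDelta ω Δ6 Δ8 ε x

/-! ### The polynomials in the numerators and the denominator -/

/-! Write x = (m, p), let (m̃, p̃) be its image y, and let Ω be the diagonal matrix with entries
`ω`. The map is given by the symmetric bilinear equations m̃ - m = ε (p × Ωp̃ + p̃ × Ωp) and p̃ - p
= ε (p × m̃ + p̃ × m). Eliminating m̃ leaves (K + [c]) p̃ = (K - [c]) p with K = 1 + ε² (p² Ω -
p·Ωp) and c = ε m + ε² p × Ωp (`reduced_system`). Let D(x, ε) be the determinant of K + [c]; it is
nonzero wherever the map is defined.

The integrals come from one identity, obtained from Cramer's rule: the numerator factor N_k =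
`clebschNum` equals D(x, ε) (1 + ε² p·Ωp̃ - ε² ω_k p·p̃). The bracket is symmetric in p and p̃ and
even in ε, and N_k is even in ε, so the reversed step gives N_k(y) / D(y, -ε) = N_k(x) / D(x, ε).
Thus the three N_k are rescaled by a common factor. The identities `mDotP_step` and `mOmegaP_step`
show that (∑ m_k p_k N_k) / p² is rescaled by the same factor. Hence d_k = p² N_k / ∑ m_j p_j N_j is
conserved, and p² = ∑ d_k m_k p_k holds along the whole orbit; this is the null-vector. The linear
relation reflects that N_k is affine in ω_k. Two exceptional cases need other null-vectors: p = 0,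
which is preserved by the map, and N_k = 0 for all k, where p·p̃ = 0 makes m·p / p² constant.

The generic statements reduce to the nonvanishing of polynomials. The denominators of the iterates
are nonzero at the fixed point 0, so Baire's theorem gives density of the regular points. The
null-space is at most a line where a five by five determinant of Ψ along the orbit is nonzero; its
numerator `minorPoly` is shown to be nonzero by linearizing at a fixed point on the p₃-axis, where
the linear map splits into two Cayley rotations with different parameters. Functional independence
is checked at one point of an explicit slice. -/

section Polynomials

variable {R : Type*} [CommRing R] (w : Fin 3 → R) (x : Fin 6 → R)

/-- `p²`. -/
def pSq : R := x 3 ^ 2 + x 4 ^ 2 + x 5 ^ 2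

/-- `m²`. -/
def mSq : R := x 0 ^ 2 + x 1 ^ 2 + x 2 ^ 2

/-- `p · Ω p`. -/
def pOmega : R := w 0 * x 3 ^ 2 + w 1 * x 4 ^ 2 + w 2 * x 5 ^ 2

/-- `m · p`. -/
def mDotP : R := x 0 * x 3 + x 1 * x 4 + x 2 * x 5

/-- `m · Ω p`. -/
def mOmegaP : R := w 0 * (x 0 * x 3) + w 1 * (x 1 * x 4) + w 2 * (x 2 * x 5)

/-- The diagonal entries of `p² Ω - (p · Ω p)`. -/
def kap (i : Fin 3) : R := w i * pSq x - pOmega w x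

/-- `p² (m · Ω p) - (p · Ω p) (m · p)`. -/
def mKapP : R := pSq x * mOmegaP w x - pOmega w x * mDotP x

/-- The square of `p × Ω p`. -/
def crossSq : R :=
  ((w 2 - w 1) * (x 4 * x 5)) ^ 2 + ((w 0 - w 2) * (x 5 * x 3)) ^ 2
    + ((w 1 - w 0) * (x 3 * x 4)) ^ 2

/-- The trace of the diagonal matrix with entries `kap`. -/
def kapTrace : R := kap w x 0 + kap w x 1 + kap w x 2

/-- The sum of the principal minors of order two of the diagonal matrix with entries `kap`. -/
def kapMinors : R :=
  kap w x 0 * kap w x 1 + kap w x 1 * kap w x 2 + kap w x 2 * kap w x 0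

/-- The part of degree four of `det K + ε⁴ g · K g - ε² m · K m`. -/
def quartic : R :=
  kapMinors w x + crossSq w x
    - (kap w x 0 * x 0 ^ 2 + kap w x 1 * x 1 ^ 2 + kap w x 2 * x 2 ^ 2)

/-- The common part of the polynomials `d_k⁽⁴⁾`. -/
def numA4 : R :=
  2 * kapMinors w x - quartic w x + pOmega w x * (kapTrace w x - mSq x)
    + 2 * (mDotP x * mOmegaP w x)

/-- The coefficient of `ω_k` in `d_k⁽⁴⁾`. -/
def numB4 : R := -(pSq x * (kapTrace w x - mSq x)) - 2 * (mDotP x * mDotP x)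

/-- The common part of the polynomials `d_k⁽⁶⁾`. -/
def numA6 : R :=
  2 * (kap w x 0 * kap w x 1 * kap w x 2) + pOmega w x * quartic w x
    + 2 * (mOmegaP w x * mKapP w x)

/-- The coefficient of `ω_k` in `d_k⁽⁶⁾`. -/
def numB6 : R := -(pSq x * quartic w x) - 2 * (mDotP x * mKapP w x)

/-- `d_k⁽⁴⁾`. -/
def num4 (k : Fin 3) : R := numA4 w x + w k * numB4 w x

/-- `d_k⁽⁶⁾`. -/
def num6 (k : Fin 3) : R := numA6 w x + w k * numB6 w x

/-- `Δ⁽⁶⁾`. -/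
def den6 : R :=
  x 0 * x 3 * num4 w x 0 + x 1 * x 4 * num4 w x 1 + x 2 * x 5 * num4 w x 2

/-- `Δ⁽⁸⁾`. -/
def den8 : R :=
  x 0 * x 3 * num6 w x 0 + x 1 * x 4 * num6 w x 1 + x 2 * x 5 * num6 w x 2

end Polynomials

/-- `d_k⁽⁴⁾` as a polynomial. -/
noncomputable def num4Poly (ω : Fin 3 → ℝ) (k : Fin 3) : MvPolynomial (Fin 6) ℝ :=
  num4 (fun i => C (ω i)) X k

/-- `d_k⁽⁶⁾` as a polynomial. -/
noncomputable def num6Poly (ω : Fin 3 → ℝ) (k : Fin 3) : MvPolynomial (Fin 6) ℝ :=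
  num6 (fun i => C (ω i)) X k

/-- `Δ⁽⁶⁾` as a polynomial. -/
noncomputable def den6Poly (ω : Fin 3 → ℝ) : MvPolynomial (Fin 6) ℝ :=
  den6 (fun i => C (ω i)) X

/-- `Δ⁽⁸⁾` as a polynomial. -/
noncomputable def den8Poly (ω : Fin 3 → ℝ) : MvPolynomial (Fin 6) ℝ :=
  den8 (fun i => C (ω i)) X

/-! ### Homogeneity of the coefficient polynomials. -/

section Homogeneous

variable (w : Fin 3 → ℝ)

local notation "cw" => (fun i => C (w i) : Fin 3 → MvPolynomial (Fin 6) ℝ)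
local notation "X6" => (X : Fin 6 → MvPolynomial (Fin 6) ℝ)

theorem isHomogeneous_C_mul {p : MvPolynomial (Fin 6) ℝ} {n : ℕ} (h : p.IsHomogeneous n)
    (a : ℝ) : (C a * p).IsHomogeneous n := by
  simpa using (isHomogeneous_C (Fin 6) a).mul h

theorem isHomogeneous_two_mul {p : MvPolynomial (Fin 6) ℝ} {n : ℕ} (h : p.IsHomogeneous n) :
    (2 * p).IsHomogeneous n := by
  have h2 : (2 : MvPolynomial (Fin 6) ℝ) = C 2 := (map_ofNat C 2).symm
  rw [h2]
  exact isHomogeneous_C_mul h 2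

theorem isHomogeneous_X_mul_X (i j : Fin 6) : (X6 i * X6 j).IsHomogeneous 2 :=
  (isHomogeneous_X ℝ i).mul (isHomogeneous_X ℝ j)

theorem isHomogeneous_X_sq (i : Fin 6) : (X6 i ^ 2).IsHomogeneous 2 := by
  rw [sq]; exact isHomogeneous_X_mul_X i i

theorem isHomogeneous_pSq : (pSq X6).IsHomogeneous 2 :=
  ((isHomogeneous_X_sq 3).add (isHomogeneous_X_sq 4)).add (isHomogeneous_X_sq 5)

theorem isHomogeneous_mSq : (mSq X6).IsHomogeneous 2 :=
  ((isHomogeneous_X_sq 0).add (isHomogeneous_X_sq 1)).add (isHomogeneous_X_sq 2)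

theorem isHomogeneous_mDotP : (mDotP X6).IsHomogeneous 2 :=
  ((isHomogeneous_X_mul_X 0 3).add (isHomogeneous_X_mul_X 1 4)).add (isHomogeneous_X_mul_X 2 5)

theorem isHomogeneous_pOmega : (pOmega cw X6).IsHomogeneous 2 :=
  ((isHomogeneous_C_mul (isHomogeneous_X_sq 3) _).add
    (isHomogeneous_C_mul (isHomogeneous_X_sq 4) _)).add
    (isHomogeneous_C_mul (isHomogeneous_X_sq 5) _)

theorem isHomogeneous_mOmegaP : (mOmegaP cw X6).IsHomogeneous 2 :=
  ((isHomogeneous_C_mul (isHomogeneous_X_mul_X 0 3) _).add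
    (isHomogeneous_C_mul (isHomogeneous_X_mul_X 1 4) _)).add
    (isHomogeneous_C_mul (isHomogeneous_X_mul_X 2 5) _)

theorem isHomogeneous_kap (i : Fin 3) : (kap cw X6 i).IsHomogeneous 2 :=
  (isHomogeneous_C_mul isHomogeneous_pSq _).sub (isHomogeneous_pOmega w)

theorem isHomogeneous_mKapP : (mKapP cw X6).IsHomogeneous 4 :=
  (isHomogeneous_pSq.mul (isHomogeneous_mOmegaP w)).sub
    ((isHomogeneous_pOmega w).mul isHomogeneous_mDotP)

theorem isHomogeneous_C_sub_mul_sq (a b : ℝ) (i j : Fin 6) :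
    (((C a - C b) * (X6 i * X6 j)) ^ 2).IsHomogeneous 4 := by
  rw [← C_sub, sq]
  exact (isHomogeneous_C_mul (isHomogeneous_X_mul_X i j) _).mul
    (isHomogeneous_C_mul (isHomogeneous_X_mul_X i j) _)

theorem isHomogeneous_crossSq : (crossSq cw X6).IsHomogeneous 4 :=
  ((isHomogeneous_C_sub_mul_sq _ _ _ _).add (isHomogeneous_C_sub_mul_sq _ _ _ _)).add
    (isHomogeneous_C_sub_mul_sq _ _ _ _)

theorem isHomogeneous_kapTrace : (kapTrace cw X6).IsHomogeneous 2 :=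
  ((isHomogeneous_kap w 0).add (isHomogeneous_kap w 1)).add (isHomogeneous_kap w 2)

theorem isHomogeneous_kapMinors : (kapMinors cw X6).IsHomogeneous 4 :=
  (((isHomogeneous_kap w 0).mul (isHomogeneous_kap w 1)).add
    ((isHomogeneous_kap w 1).mul (isHomogeneous_kap w 2))).add
    ((isHomogeneous_kap w 2).mul (isHomogeneous_kap w 0))

theorem isHomogeneous_quartic : (quartic cw X6).IsHomogeneous 4 :=
  ((isHomogeneous_kapMinors w).add (isHomogeneous_crossSq w)).sub
    ((((isHomogeneous_kap w 0).mul (isHomogeneous_X_sq 0)).add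
    ((isHomogeneous_kap w 1).mul (isHomogeneous_X_sq 1))).add
    ((isHomogeneous_kap w 2).mul (isHomogeneous_X_sq 2)))

theorem isHomogeneous_num4 (k : Fin 3) : (num4Poly w k).IsHomogeneous 4 := by
  refine IsHomogeneous.add (IsHomogeneous.add (IsHomogeneous.add (IsHomogeneous.sub ?_ ?_) ?_) ?_)
    (isHomogeneous_C_mul (IsHomogeneous.sub (IsHomogeneous.neg ?_) ?_) _)
  · exact isHomogeneous_two_mul (isHomogeneous_kapMinors w)
  · exact isHomogeneous_quartic w
  · exact (isHomogeneous_pOmega w).mul ((isHomogeneous_kapTrace w).sub isHomogeneous_mSq)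
  · exact isHomogeneous_two_mul (isHomogeneous_mDotP.mul (isHomogeneous_mOmegaP w))
  · exact isHomogeneous_pSq.mul ((isHomogeneous_kapTrace w).sub isHomogeneous_mSq)
  · exact isHomogeneous_two_mul (isHomogeneous_mDotP.mul isHomogeneous_mDotP)

theorem isHomogeneous_num6 (k : Fin 3) : (num6Poly w k).IsHomogeneous 6 := by
  refine IsHomogeneous.add (IsHomogeneous.add (IsHomogeneous.add ?_ ?_) ?_)
    (isHomogeneous_C_mul (IsHomogeneous.sub (IsHomogeneous.neg ?_) ?_) _)
  · exact isHomogeneous_two_mul ((((isHomogeneous_kap w 0).mul (isHomogeneous_kap w 1)).mul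
      (isHomogeneous_kap w 2)))
  · exact (isHomogeneous_pOmega w).mul (isHomogeneous_quartic w)
  · exact isHomogeneous_two_mul ((isHomogeneous_mOmegaP w).mul (isHomogeneous_mKapP w))
  · exact isHomogeneous_pSq.mul (isHomogeneous_quartic w)
  · exact isHomogeneous_two_mul (isHomogeneous_mDotP.mul (isHomogeneous_mKapP w))

theorem isHomogeneous_den6 : (den6Poly w).IsHomogeneous 6 :=
  (((isHomogeneous_X_mul_X 0 3).mul (isHomogeneous_num4 w 0)).add
    ((isHomogeneous_X_mul_X 1 4).mul (isHomogeneous_num4 w 1))).add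
    ((isHomogeneous_X_mul_X 2 5).mul (isHomogeneous_num4 w 2))

theorem isHomogeneous_den8 : (den8Poly w).IsHomogeneous 8 :=
  (((isHomogeneous_X_mul_X 0 3).mul (isHomogeneous_num6 w 0)).add
    ((isHomogeneous_X_mul_X 1 4).mul (isHomogeneous_num6 w 1))).add
    ((isHomogeneous_X_mul_X 2 5).mul (isHomogeneous_num6 w 2))

end Homogeneous

/-! ### Values of the polynomials and the integrals as quotients. -/

theorem eval_num4Poly (ω : Fin 3 → ℝ) (k : Fin 3) (x : Phase) :
    eval x (num4Poly ω k) = num4 ω x k := by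
  simp [num4Poly, num4, numA4, numB4, kapMinors, quartic, crossSq, kapTrace, kap, mSq,
    pSq, mDotP, mOmegaP, pOmega]

theorem eval_num6Poly (ω : Fin 3 → ℝ) (k : Fin 3) (x : Phase) :
    eval x (num6Poly ω k) = num6 ω x k := by
  simp [num6Poly, num6, numA6, numB6, kapMinors, quartic, crossSq, kap, mKapP,
    pSq, mDotP, mOmegaP, pOmega]

theorem eval_den6Poly (ω : Fin 3 → ℝ) (x : Phase) : eval x (den6Poly ω) = den6 ω x := by
  simp only [den6, ← eval_num4Poly]
  simp [den6Poly, den6, num4Poly]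

theorem eval_den8Poly (ω : Fin 3 → ℝ) (x : Phase) : eval x (den8Poly ω) = den8 ω x := by
  simp only [den8, ← eval_num6Poly]
  simp [den8Poly, den8, num6Poly]

/-- The factor `1 + ε² d_k⁽²⁾ + ε⁴ d_k⁽⁴⁾ + ε⁶ d_k⁽⁶⁾` of the numerator of `d_k`. -/
noncomputable def clebschNum (ω : Fin 3 → ℝ) (ε : ℝ) (k : Fin 3) (x : Phase) : ℝ :=
  1 + ε ^ 2 * clebschD2 ω k x + ε ^ 4 * num4 ω x k + ε ^ 6 * num6 ω x k

/-- The denominator of `d_k`, as a combination of the `m_k p_k`. -/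
noncomputable def clebschDen (ω : Fin 3 → ℝ) (ε : ℝ) (x : Phase) : ℝ :=
  x 0 * x 3 * clebschNum ω ε 0 x + x 1 * x 4 * clebschNum ω ε 1 x
    + x 2 * x 5 * clebschNum ω ε 2 x

theorem clebschDelta_eq (ω : Fin 3 → ℝ) (ε : ℝ) (x : Phase) :
    clebschDelta ω (den6Poly ω) (den8Poly ω) ε x = clebschDen ω ε x := by
  simp only [clebschDelta, clebschDen, eval_den6Poly, eval_den8Poly, clebschDelta4, den6, den8,
    clebschNum]
  ring

theorem clebschD_eq (ω : Fin 3 → ℝ) (ε : ℝ) (k : Fin 3) (x : Phase) :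
    clebschD ω (num4Poly ω) (num6Poly ω) (den6Poly ω) (den8Poly ω) ε k x =
      pSq x * clebschNum ω ε k x / clebschDen ω ε x := by
  rw [clebschD, clebschDelta_eq, eval_num4Poly, eval_num6Poly, clebschNum, pSq]

/-- Evenness allows a formula for the numerators at x to be reused at the image, where the reversed
step has parameter -ε. -/
theorem clebschNum_neg (ω : Fin 3 → ℝ) (ε : ℝ) (k : Fin 3) (x : Phase) :
    clebschNum ω (-ε) k x = clebschNum ω ε k x := by
  simp [clebschNum, Even.neg_pow (by decide : Even 2), Even.neg_pow (by decide : Even 4),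
    Even.neg_pow (by decide : Even 6)]

theorem clebschDen_neg (ω : Fin 3 → ℝ) (ε : ℝ) (x : Phase) :
    clebschDen ω (-ε) x = clebschDen ω ε x := by
  simp only [clebschDen, clebschNum_neg]

/-- The index k enters only through ω_k, and linearly; this is the source of the linear relation. -/
theorem clebschNum_affine (ω : Fin 3 → ℝ) (ε : ℝ) (k : Fin 3) (x : Phase) :
    clebschNum ω ε k x =
      (1 + ε ^ 2 * (kapTrace ω x + mSq x + pOmega ω x) + ε ^ 4 * numA4 ω x + ε ^ 6 * numA6 ω x)
        + ω k * (-(ε ^ 2 * pSq x) + ε ^ 4 * numB4 ω x + ε ^ 6 * numB6 ω x) := by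
  have h : clebschD2 ω k x = kapTrace ω x + mSq x + pOmega ω x - ω k * pSq x := by
    fin_cases k <;> simp [clebschD2, kapTrace, kap, mSq, pSq, pOmega] <;> ring
  rw [clebschNum, h, num4, num6]
  ring

/-- The linear relation between the numerators. -/
theorem clebschNum_linear_relation (ω : Fin 3 → ℝ) (ε : ℝ) (x : Phase) :
    (ω 1 - ω 2) * clebschNum ω ε 0 x + (ω 2 - ω 0) * clebschNum ω ε 1 x
      + (ω 0 - ω 1) * clebschNum ω ε 2 x = 0 := by
  simp only [clebschNum_affine]
  ring

/-! ### The reduced system for the variables `p` -/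

/-- The diagonal entries of the symmetric part of the reduced matrix. -/
noncomputable def redDiag (ω : Fin 3 → ℝ) (ε : ℝ) (x : Phase) (i : Fin 3) : ℝ :=
  1 + ε ^ 2 * kap ω x i

/-- The axial vector of the antisymmetric part of the reduced matrix. -/
noncomputable def redAxial (ω : Fin 3 → ℝ) (ε : ℝ) (x : Phase) : Fin 3 → ℝ :=
  ![ε * x 0 + ε ^ 2 * ((ω 2 - ω 1) * (x 4 * x 5)),
    ε * x 1 + ε ^ 2 * ((ω 0 - ω 2) * (x 5 * x 3)),
    ε * x 2 + ε ^ 2 * ((ω 1 - ω 0) * (x 3 * x 4))]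

/-- The determinant of the reduced matrix `K + [c]`. -/
noncomputable def redDet (ω : Fin 3 → ℝ) (ε : ℝ) (x : Phase) : ℝ :=
  redDiag ω ε x 0 * redDiag ω ε x 1 * redDiag ω ε x 2
    + redDiag ω ε x 0 * redAxial ω ε x 0 ^ 2 + redDiag ω ε x 1 * redAxial ω ε x 1 ^ 2
    + redDiag ω ε x 2 * redAxial ω ε x 2 ^ 2

/-- A linear system with matrix `K + [c]`, where `K` is diagonal and `[c]` is antisymmetric,
is solved by Cramer's rule. -/
theorem cramer_diag_add_cross {k₀ k₁ k₂ c₀ c₁ c₂ a₀ a₁ a₂ v₀ v₁ v₂ : ℝ}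
    (h₀ : k₀ * v₀ + (c₁ * v₂ - c₂ * v₁) = a₀)
    (h₁ : k₁ * v₁ + (c₂ * v₀ - c₀ * v₂) = a₁)
    (h₂ : k₂ * v₂ + (c₀ * v₁ - c₁ * v₀) = a₂) :
    let D := k₀ * k₁ * k₂ + k₀ * c₀ ^ 2 + k₁ * c₁ ^ 2 + k₂ * c₂ ^ 2
    let t := c₀ * a₀ + c₁ * a₁ + c₂ * a₂
    D * v₀ = k₁ * k₂ * a₀ + c₀ * t - (k₁ * c₁ * a₂ - k₂ * c₂ * a₁) ∧
    D * v₁ = k₂ * k₀ * a₁ + c₁ * t - (k₂ * c₂ * a₀ - k₀ * c₀ * a₂) ∧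
    D * v₂ = k₀ * k₁ * a₂ + c₂ * t - (k₀ * c₀ * a₁ - k₁ * c₁ * a₀) := by
  subst h₀ h₁ h₂
  refine ⟨?_, ?_, ?_⟩ <;> ring

/-- The equation for the new `p`, without the new `m`. -/
theorem reduced_system {ω : Fin 3 → ℝ} {ε : ℝ} {x y : Phase}
    (h : Matrix.mulVec (clebschMatrix ω ε x) y = x) :
    redDiag ω ε x 0 * y 3 + (redAxial ω ε x 1 * y 5 - redAxial ω ε x 2 * y 4) =
      redDiag ω ε x 0 * x 3 - (redAxial ω ε x 1 * x 5 - redAxial ω ε x 2 * x 4) ∧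
    redDiag ω ε x 1 * y 4 + (redAxial ω ε x 2 * y 3 - redAxial ω ε x 0 * y 5) =
      redDiag ω ε x 1 * x 4 - (redAxial ω ε x 2 * x 3 - redAxial ω ε x 0 * x 5) ∧
    redDiag ω ε x 2 * y 5 + (redAxial ω ε x 0 * y 4 - redAxial ω ε x 1 * y 3) =
      redDiag ω ε x 2 * x 5 - (redAxial ω ε x 0 * x 4 - redAxial ω ε x 1 * x 3) := by
  rw [clebschMatrix_mulVec_eq_iff] at h
  obtain ⟨h0, h1, h2, h3, h4, h5⟩ := h
  simp only [redDiag, redAxial, kap, pSq, pOmega, Matrix.cons_val]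
  refine ⟨?_, ?_, ?_⟩
  -- Adding ε p × (m-equation) to the p-equation eliminates m̃.
  · linear_combination h3 + ε * x 4 * h2 - ε * x 5 * h1
  · linear_combination h4 + ε * x 5 * h0 - ε * x 3 * h2
  · linear_combination h5 + ε * x 3 * h1 - ε * x 4 * h0

/-- The numerators of `d_k` in terms of `x` and its image. -/
theorem clebschNum_eq_redDet_mul {ω : Fin 3 → ℝ} {ε : ℝ} {x y : Phase}
    (h : Matrix.mulVec (clebschMatrix ω ε x) y = x) (k : Fin 3) :
    clebschNum ω ε k x = redDet ω ε x * (1 + ε ^ 2 * (ω 0 * (x 3 * y 3) + ω 1 * (x 4 * y 4)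
      + ω 2 * (x 5 * y 5)) - ε ^ 2 * ω k * (x 3 * y 3 + x 4 * y 4 + x 5 * y 5)) := by
  obtain ⟨h0, h1, h2⟩ := reduced_system h
  obtain ⟨e0, e1, e2⟩ := cramer_diag_add_cross h0 h1 h2
  clear h h0 h1 h2
  -- In this form p̃ occurs only multiplied by D, so Cramer's rule turns the claim into a polynomial
  -- identity in x.
  have key : clebschNum ω ε k x = redDet ω ε x + ε ^ 2 * ((ω 0 - ω k) * x 3 * (redDet ω ε x * y 3)
      + (ω 1 - ω k) * x 4 * (redDet ω ε x * y 4) + (ω 2 - ω k) * x 5 * (redDet ω ε x * y 5)) := by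
    simp only [redDet]
    rw [e0, e1, e2, clebschNum_affine]
    simp only [redDiag, redAxial, Matrix.cons_val, numA4, numB4, numA6, numB6, kapMinors, quartic,
      crossSq, kapTrace, kap, mKapP, pSq, mSq, mDotP, mOmegaP, pOmega]
    -- The identity holds with ω_k replaced by a free variable, so no case distinction on k is
    -- needed.
    generalize ω k = z
    ring
  rw [key]
  ring

/-! ### One step of the map -/

theorem clebschMatrix_neg_mulVec {ω : Fin 3 → ℝ} {ε : ℝ} {x y : Phase}
    (h : Matrix.mulVec (clebschMatrix ω ε x) y = x) :
    Matrix.mulVec (clebschMatrix ω (-ε) y) x = y := by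
  rw [clebschMatrix_mulVec_eq_iff] at h ⊢
  obtain ⟨h0, h1, h2, h3, h4, h5⟩ := h
  refine ⟨?_, ?_, ?_, ?_, ?_, ?_⟩ <;> linarith

theorem clebschMatrix_mulVec_clebschMap {ω : Fin 3 → ℝ} {ε : ℝ} {x : Phase}
    (hx : x ∈ clebschDomain ω ε) :
    Matrix.mulVec (clebschMatrix ω ε x) (clebschMap ω ε x) = x := by
  rw [clebschMap, Matrix.mulVec_mulVec, Matrix.mul_nonsing_inv _ (Ne.isUnit hx),
    Matrix.one_mulVec]

/-- The reduced determinant does not vanish on the domain of the map, since a kernel vector of the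
reduced matrix lifts to one of `M(x, ε)`. -/
theorem redDet_ne_zero {ω : Fin 3 → ℝ} {ε : ℝ} {x : Phase} (hx : x ∈ clebschDomain ω ε) :
    redDet ω ε x ≠ 0 := by
  intro h0
  set k := redDiag ω ε x with hk
  set c := redAxial ω ε x with hc
  let L : Matrix (Fin 3) (Fin 3) ℝ :=
    !![k 0, -c 2, c 1; c 2, k 1, -c 0; -c 1, c 0, k 2]
  have hL : L.det = 0 := by
    rw [← h0, Matrix.det_fin_three]
    simp only [L, redDet, ← hk, ← hc, Matrix.of_apply, Matrix.cons_val]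
    ring
  obtain ⟨v, hv, hLv⟩ := Matrix.exists_mulVec_eq_zero_iff.2 hL
  have e0 := congrFun hLv 0
  have e1 := congrFun hLv 1
  have e2 := congrFun hLv 2
  simp only [L, Matrix.mulVec, dotProduct, Fin.sum_univ_three, Matrix.of_apply,
    Matrix.cons_val, Pi.zero_apply, hk, hc, redDiag, redAxial, kap, pSq, pOmega] at e0 e1 e2
  let V : Phase := ![ε * (ω 2 - ω 1) * (v 1 * x 5 + v 2 * x 4),
    ε * (ω 0 - ω 2) * (v 2 * x 3 + v 0 * x 5), ε * (ω 1 - ω 0) * (v 0 * x 4 + v 1 * x 3),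
    v 0, v 1, v 2]
  have hV : Matrix.mulVec (clebschMatrix ω ε x) V = 0 := by
    ext i
    fin_cases i <;>
      simp only [V, clebschMatrix, Matrix.mulVec, dotProduct, Fin.sum_univ_six, Matrix.of_apply,
        Matrix.cons_val, Pi.zero_apply, Fin.zero_eta, Fin.mk_one, Fin.reduceFinMk]
    · ring
    · ring
    · ring
    · linear_combination e0
    · linear_combination e1
    · linear_combination e2
  have hV0 : V ≠ 0 := by
    intro h
    apply hv
    ext i
    fin_cases i
    · exact congrFun h 3
    · exact congrFun h 4
    · exact congrFun h 5
  exact hx (Matrix.exists_mulVec_eq_zero_iff.1 ⟨V, hV0, hV⟩)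

section Step

variable {ω : Fin 3 → ℝ} {ε : ℝ} {x y : Phase}

/-- The numerators are multiplied by a common factor under the map. -/
theorem redDet_mul_clebschNum (h : Matrix.mulVec (clebschMatrix ω ε x) y = x) (k : Fin 3) :
    redDet ω ε x * clebschNum ω ε k y = redDet ω (-ε) y * clebschNum ω ε k x := by
  rw [← clebschNum_neg ω ε k y, clebschNum_eq_redDet_mul h,
    clebschNum_eq_redDet_mul (clebschMatrix_neg_mulVec h)]
  ring

/-- Pairing p̃ - p = ε (p × m̃ + p̃ × m) with p̃ × p annihilates the left side; after cancelling ε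
the rest expands to this identity. -/
theorem mDotP_step (hε : ε ≠ 0) (h : Matrix.mulVec (clebschMatrix ω ε x) y = x) :
    mDotP y * pSq x - mDotP x * pSq y = -((x 3 * y 3 + x 4 * y 4 + x 5 * y 5) *
      (x 0 * y 3 + x 1 * y 4 + x 2 * y 5 - (y 0 * x 3 + y 1 * x 4 + y 2 * x 5))) := by
  rw [clebschMatrix_mulVec_eq_iff] at h
  obtain ⟨-, -, -, h3, h4, h5⟩ := h
  apply mul_left_cancel₀ hε
  simp only [mDotP, pSq]
  linear_combination (y 4 * x 5 - y 5 * x 4) * h3 + (y 5 * x 3 - y 3 * x 5) * h4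
    + (y 3 * x 4 - y 4 * x 3) * h5

/-- The m-equation is paired with ε m̃ × p - p and the p-equation with ε p̃ × Ωp + m. The right side
has the same factor m·p̃ - m̃·p as in `mDotP_step`, so that this factor can be eliminated between
the two. -/
theorem mOmegaP_step (h : Matrix.mulVec (clebschMatrix ω ε x) y = x) :
    ε ^ 2 * (mOmegaP ω y * pSq x - mOmegaP ω x * pSq y) =
      -((1 + ε ^ 2 * (ω 0 * (x 3 * y 3) + ω 1 * (x 4 * y 4) + ω 2 * (x 5 * y 5))) *
      (x 0 * y 3 + x 1 * y 4 + x 2 * y 5 - (y 0 * x 3 + y 1 * x 4 + y 2 * x 5))) := by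
  rw [clebschMatrix_mulVec_eq_iff] at h
  obtain ⟨h0, h1, h2, h3, h4, h5⟩ := h
  simp only [mOmegaP, pSq]
  linear_combination
    (ε * (y 1 * x 5 - y 2 * x 4) - x 3) * h0 + (ε * (y 2 * x 3 - y 0 * x 5) - x 4) * h1
    + (ε * (y 0 * x 4 - y 1 * x 3) - x 5) * h2
    + (ε * (y 4 * (ω 2 * x 5) - y 5 * (ω 1 * x 4)) + x 0) * h3
    + (ε * (y 5 * (ω 0 * x 3) - y 3 * (ω 2 * x 5)) + x 1) * h4
    + (ε * (y 3 * (ω 1 * x 4) - y 4 * (ω 0 * x 3)) + x 2) * h5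

theorem clebschDen_eq_redDet_mul (h : Matrix.mulVec (clebschMatrix ω ε x) y = x) :
    clebschDen ω ε x = redDet ω ε x *
      ((1 + ε ^ 2 * (ω 0 * (x 3 * y 3) + ω 1 * (x 4 * y 4) + ω 2 * (x 5 * y 5))) * mDotP x
        - ε ^ 2 * (x 3 * y 3 + x 4 * y 4 + x 5 * y 5) * mOmegaP ω x) := by
  simp only [clebschDen, clebschNum_eq_redDet_mul h, mDotP, mOmegaP]
  ring

/-- The denominators, divided by `p²`, are multiplied by the same factor as the numerators. -/
theorem redDet_mul_clebschDen (hε : ε ≠ 0) (h : Matrix.mulVec (clebschMatrix ω ε x) y = x) :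
    redDet ω ε x * (clebschDen ω ε y * pSq x) = redDet ω (-ε) y * (clebschDen ω ε x * pSq y) := by
  rw [← clebschDen_neg ω ε y, clebschDen_eq_redDet_mul h,
    clebschDen_eq_redDet_mul (clebschMatrix_neg_mulVec h)]
  -- Cross-multiplying the two step identities cancels m·p̃ - m̃·p.
  linear_combination redDet ω ε x * redDet ω (-ε) y *
    ((1 + ε ^ 2 * (ω 0 * (x 3 * y 3) + ω 1 * (x 4 * y 4) + ω 2 * (x 5 * y 5))) * mDotP_step hε h
      - (x 3 * y 3 + x 4 * y 4 + x 5 * y 5) * mOmegaP_step h)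

theorem pSq_eq_zero_iff (x : Phase) : pSq x = 0 ↔ x 3 = 0 ∧ x 4 = 0 ∧ x 5 = 0 := by
  constructor
  · intro h
    unfold pSq at h
    refine ⟨?_, ?_, ?_⟩ <;> nlinarith [sq_nonneg (x 3), sq_nonneg (x 4), sq_nonneg (x 5)]
  · rintro ⟨h3, h4, h5⟩
    simp [pSq, h3, h4, h5]

/-- At p = 0 the right side of the reduced system vanishes while its determinant does not. -/
theorem pSq_image_eq_zero (hx : x ∈ clebschDomain ω ε)
    (h : Matrix.mulVec (clebschMatrix ω ε x) y = x) (h0 : pSq x = 0) : pSq y = 0 := by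
  rw [pSq_eq_zero_iff] at h0 ⊢
  obtain ⟨h3, h4, h5⟩ := h0
  obtain ⟨e3, e4, e5⟩ := reduced_system h
  rw [h3, h4, h5] at e3 e4 e5
  obtain ⟨e3, e4, e5⟩ := cramer_diag_add_cross e3 e4 e5
  have hD := redDet_ne_zero hx
  rw [redDet] at hD
  refine ⟨mul_left_cancel₀ hD ?_, mul_left_cancel₀ hD ?_, mul_left_cancel₀ hD ?_⟩
  · rw [e3]; ring
  · rw [e4]; ring
  · rw [e5]; ring

theorem pSq_image_eq_zero_iff (hx : x ∈ clebschDomain ω ε) (hy : y ∈ clebschDomain ω (-ε))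
    (h : Matrix.mulVec (clebschMatrix ω ε x) y = x) : pSq y = 0 ↔ pSq x = 0 :=
  ⟨pSq_image_eq_zero hy (clebschMatrix_neg_mulVec h), pSq_image_eq_zero hx h⟩

end Step

/-- `d₇, d₈, d₉` are integrals of the map. -/
theorem isIntegralOfMotion_clebschD {ω : Fin 3 → ℝ} {ε : ℝ} (hε : ε ≠ 0) (k : Fin 3) :
    IsIntegralOfMotion (clebschMap ω ε) (clebschDomain ω ε)
      (clebschD ω (num4Poly ω) (num6Poly ω) (den6Poly ω) (den8Poly ω) ε k)
      {x | clebschDelta ω (den6Poly ω) (den8Poly ω) ε x ≠ 0} := by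
  intro x hx hΔx hΔy
  simp only [Set.mem_ofPred_eq, clebschDelta_eq] at hΔx hΔy
  have h := clebschMatrix_mulVec_clebschMap hx
  have hD := redDet_ne_zero hx
  generalize clebschMap ω ε x = y at *
  rw [clebschD_eq, clebschD_eq, div_eq_div_iff hΔy hΔx]
  apply mul_left_cancel₀ hD
  linear_combination (pSq y * clebschDen ω ε x) * redDet_mul_clebschNum h k
    - clebschNum ω ε k x * redDet_mul_clebschDen hε h

/-! ### The null-space along regular orbits -/

/-- A property of integers that holds at `0` and is passed on in both directions holds
everywhere. -/
theorem Int.forall_of_step {P : ℤ → Prop} (h0 : P 0) (h : ∀ i, P i ↔ P (i + 1)) (i : ℤ) : P i := by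
  induction i using Int.induction_on with
  | zero => exact h0
  | succ i hi => exact (h _).1 hi
  | pred i hi => exact (h _).2 (by simpa using hi)

section Orbit

variable {ω : Fin 3 → ℝ} {ε : ℝ} {x : Phase}

theorem clebschIter_step (hx : x ∈ clebschRegular ω ε) (i : ℤ) :
    Matrix.mulVec (clebschMatrix ω ε (clebschIter ω ε i x)) (clebschIter ω ε (i + 1) x)
      = clebschIter ω ε i x := by
  rw [clebschIter_add_one ω ε x hx i]
  exact clebschMatrix_mulVec_clebschMap (hx i).1

theorem clebschIter_zero (ω : Fin 3 → ℝ) (ε : ℝ) (x : Phase) : clebschIter ω ε 0 x = x := rfl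

theorem pSq_clebschIter (hx : x ∈ clebschRegular ω ε) (i : ℤ) :
    pSq (clebschIter ω ε i x) = 0 ↔ pSq x = 0 := by
  refine Int.forall_of_step (P := fun i => pSq (clebschIter ω ε i x) = 0 ↔ pSq x = 0)
    Iff.rfl (fun i => ?_) i
  show _ ↔ _
  rw [pSq_image_eq_zero_iff (hx i).1 (hx (i + 1)).2 (clebschIter_step hx i)]

/-- Along a regular orbit the numerators, and the denominator divided by `p²`, stay
proportional. -/
theorem clebschNum_clebschIter (hε : ε ≠ 0) (hx : x ∈ clebschRegular ω ε) (hp : pSq x ≠ 0)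
    (i : ℤ) : ∃ r : ℝ, r ≠ 0 ∧
      (∀ k, clebschNum ω ε k (clebschIter ω ε i x) = r * clebschNum ω ε k x) ∧
      clebschDen ω ε (clebschIter ω ε i x) * pSq x =
        r * (clebschDen ω ε x * pSq (clebschIter ω ε i x)) := by
  refine Int.forall_of_step (P := fun i => ∃ r : ℝ, r ≠ 0 ∧
      (∀ k, clebschNum ω ε k (clebschIter ω ε i x) = r * clebschNum ω ε k x) ∧
      clebschDen ω ε (clebschIter ω ε i x) * pSq x =
        r * (clebschDen ω ε x * pSq (clebschIter ω ε i x)))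
    ⟨1, one_ne_zero, by simp [clebschIter_zero]⟩ (fun i => ?_) i
  have hD := redDet_ne_zero (hx i).1
  have hD' := redDet_ne_zero (hx (i + 1)).2
  have hN := redDet_mul_clebschNum (clebschIter_step hx i)
  have hΔ := redDet_mul_clebschDen hε (clebschIter_step hx i)
  have hp1 : pSq (clebschIter ω ε i x) ≠ 0 := fun h => hp ((pSq_clebschIter hx i).1 h)
  have hp2 : pSq (clebschIter ω ε (i + 1) x) ≠ 0 :=
    fun h => hp ((pSq_clebschIter hx (i + 1)).1 h)
  generalize clebschIter ω ε i x = y at *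
  generalize clebschIter ω ε (i + 1) x = z at *
  constructor
  · rintro ⟨r, hr, h1, h2⟩
    -- One step multiplies the factor by D(z, -ε) / D(y, ε), which is nonzero, so the backward
    -- direction can divide by it.
    refine ⟨redDet ω (-ε) z / redDet ω ε y * r, by positivity, fun k => ?_, ?_⟩
    · field_simp
      linear_combination hN k + redDet ω (-ε) z * h1 k
    · field_simp
      apply mul_left_cancel₀ hp1
      linear_combination pSq x * hΔ + redDet ω (-ε) z * pSq z * h2
  · rintro ⟨r, hr, h1, h2⟩
    refine ⟨redDet ω ε y / redDet ω (-ε) z * r, by positivity, fun k => ?_, ?_⟩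
    · field_simp
      linear_combination redDet ω ε y * h1 k - hN k
    · field_simp
      apply mul_left_cancel₀ hp2
      linear_combination redDet ω ε y * pSq y * h2 - pSq x * hΔ

/-- The polynomial null-vector. -/
theorem mem_hkNullSpace (hε : ε ≠ 0) (hx : x ∈ clebschRegular ω ε) (hp : pSq x ≠ 0) :
    ![-clebschDen ω ε x, -clebschDen ω ε x, -clebschDen ω ε x, pSq x * clebschNum ω ε 0 x,
      pSq x * clebschNum ω ε 1 x, pSq x * clebschNum ω ε 2 x] ∈
      hkNullSpace (clebschIter ω ε) clebschPsi x := by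
  intro i
  obtain ⟨r, hr, h1, h2⟩ := clebschNum_clebschIter hε hx hp i
  generalize clebschIter ω ε i x = y at *
  simp only [Fin.sum_univ_six, clebschPsi, Matrix.cons_val]
  rw [clebschDen, h1, h1, h1, pSq.eq_def y] at h2
  apply mul_left_cancel₀ hr
  linear_combination h2

/-- `[-1 : -1 : -1 : d₇ : d₈ : d₉]` lies in the null-space wherever it is defined. -/
theorem clebschD_mem_hkNullSpace (hε : ε ≠ 0) (hx : x ∈ clebschRegular ω ε)
    (hΔ : clebschDelta ω (den6Poly ω) (den8Poly ω) ε x ≠ 0) :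
    ![-1, -1, -1, clebschD ω (num4Poly ω) (num6Poly ω) (den6Poly ω) (den8Poly ω) ε 0 x,
      clebschD ω (num4Poly ω) (num6Poly ω) (den6Poly ω) (den8Poly ω) ε 1 x,
      clebschD ω (num4Poly ω) (num6Poly ω) (den6Poly ω) (den8Poly ω) ε 2 x] ∈
      hkNullSpace (clebschIter ω ε) clebschPsi x := by
  rw [clebschDelta_eq] at hΔ
  have hp : pSq x ≠ 0 := by
    intro h
    obtain ⟨h3, h4, h5⟩ := (pSq_eq_zero_iff x).1 h
    exact hΔ (by simp [clebschDen, h3, h4, h5])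
  have h := Submodule.smul_mem _ (clebschDen ω ε x)⁻¹ (mem_hkNullSpace hε hx hp)
  convert h using 1
  ext j
  fin_cases j <;> simp [clebschD_eq, hΔ] <;> field_simp

/-- Where all numerators vanish, `m · p` and `p²` are proportional along the orbit. -/
theorem mDotP_clebschIter (hω : Function.Injective ω) (hε : ε ≠ 0)
    (hx : x ∈ clebschRegular ω ε) (hp : pSq x ≠ 0) (hN : ∀ k, clebschNum ω ε k x = 0) (i : ℤ) :
    mDotP (clebschIter ω ε i x) * pSq x = mDotP x * pSq (clebschIter ω ε i x) := by
  refine Int.forall_of_step (P := fun i =>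
    mDotP (clebschIter ω ε i x) * pSq x = mDotP x * pSq (clebschIter ω ε i x)) rfl (fun i => ?_) i
  obtain ⟨r, hr, h1, -⟩ := clebschNum_clebschIter hε hx hp i
  have hD := redDet_ne_zero (hx i).1
  have hR := mDotP_step hε (clebschIter_step hx i)
  have hn := clebschNum_eq_redDet_mul (clebschIter_step hx i)
  have hp1 : pSq (clebschIter ω ε i x) ≠ 0 := fun h => hp ((pSq_clebschIter hx i).1 h)
  have hp2 : pSq (clebschIter ω ε (i + 1) x) ≠ 0 :=
    fun h => hp ((pSq_clebschIter hx (i + 1)).1 h)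
  generalize clebschIter ω ε i x = y at *
  generalize clebschIter ω ε (i + 1) x = z at *
  simp only [h1, hN, mul_zero] at hn
  have h01 : ω 0 - ω 1 ≠ 0 := sub_ne_zero.2 (hω.ne (by decide))
  -- Subtracting the vanishing numerators for k = 0 and k = 1 leaves a nonzero multiple of p·p̃.
  have hq : y 3 * z 3 + y 4 * z 4 + y 5 * z 5 = 0 := by
    have : redDet ω ε y * ε ^ 2 * (ω 0 - ω 1) * (y 3 * z 3 + y 4 * z 4 + y 5 * z 5) = 0 := by
      linear_combination hn 0 - hn 1
    exact (mul_eq_zero.1 this).resolve_left (by positivity)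
  rw [hq, zero_mul, neg_zero] at hR
  constructor
  · intro h
    apply mul_left_cancel₀ hp1
    linear_combination pSq x * hR + pSq z * h
  · intro h
    apply mul_left_cancel₀ hp2
    linear_combination pSq y * h - pSq x * hR

/-! ### The Hirota-Kimura basis property. -/

theorem linearIndependent_clebschPsi : LinearIndependent ℝ clebschPsi := by
  rw [Fintype.linearIndependent_iff]
  intro g hg
  have key : ∀ x : Phase, ∑ j, g j * clebschPsi j x = 0 := by
    intro x
    have := congrFun hg x
    simpa [Finset.sum_apply] using this
  have e0 := key ![0, 0, 0, 1, 0, 0]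
  have e1 := key ![0, 0, 0, 0, 1, 0]
  have e2 := key ![0, 0, 0, 0, 0, 1]
  have e3 := key ![1, 0, 0, 1, 0, 0]
  have e4 := key ![0, 1, 0, 0, 1, 0]
  have e5 := key ![0, 0, 1, 0, 0, 1]
  simp only [Fin.sum_univ_six, clebschPsi, Matrix.cons_val] at e0 e1 e2 e3 e4 e5
  intro i
  fin_cases i <;> simp only [Fin.zero_eta, Fin.mk_one, Fin.reduceFinMk] <;> linarith

/-- `Ψ` is a Hirota-Kimura basis. -/
theorem isHKBasis_clebschPsi (hω : Function.Injective ω) (hε : ε ≠ 0) :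
    IsHKBasis (clebschIter ω ε) (clebschRegular ω ε) clebschPsi := by
  refine ⟨linearIndependent_clebschPsi, fun x hx => ?_⟩
  by_cases hp : pSq x = 0
  -- Here p = 0 along the orbit and every vector is a null-vector.
  · refine ⟨![1, 0, 0, 0, 0, 0], fun i => ?_, fun h => one_ne_zero (congrFun h 0)⟩
    obtain ⟨h3, -, -⟩ := (pSq_eq_zero_iff _).1 ((pSq_clebschIter hx i).2 hp)
    simp [Fin.sum_univ_six, clebschPsi, h3]
  by_cases hN : ∀ k, clebschNum ω ε k x = 0
  -- The polynomial null-vector vanishes here; the constancy of m·p / p² supplies another one.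
  · refine ⟨![-mDotP x, -mDotP x, -mDotP x, pSq x, pSq x, pSq x], fun i => ?_,
      fun h => hp (congrFun h 3)⟩
    have h := mDotP_clebschIter hω hε hx hp hN i
    generalize clebschIter ω ε i x = y at *
    rw [mDotP.eq_def y, pSq.eq_def y] at h
    simp only [Fin.sum_univ_six, clebschPsi, Matrix.cons_val]
    linear_combination h
  · refine ⟨_, mem_hkNullSpace hε hx hp, fun h => hN fun k => ?_⟩
    fin_cases k
    · exact (mul_eq_zero.1 (congrFun h 3)).resolve_left hp
    · exact (mul_eq_zero.1 (congrFun h 4)).resolve_left hp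
    · exact (mul_eq_zero.1 (congrFun h 5)).resolve_left hp

end Orbit

/-! ### Polynomial form of the iterates and density of the regular points -/

/-- A polynomial vanishing on a nonempty open set vanishes on a product of infinite sets, hence
identically. -/
theorem dense_eval_ne_zero {n : ℕ} {p : MvPolynomial (Fin n) ℝ} (hp : p ≠ 0) :
    Dense {x : Fin n → ℝ | eval x p ≠ 0} := by
  rw [dense_iff_inter_open]
  rintro U hU ⟨x, hx⟩
  by_contra hne
  apply hp
  obtain ⟨r, hr, hball⟩ := Metric.isOpen_iff.1 hU x hx
  refine funext_set (fun i => Metric.ball (x i) r) (fun i => ?_) fun y hy => ?_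
  · rw [Real.ball_eq_Ioo]
    exact Set.Ioo_infinite (by linarith)
  · rw [map_zero]
    by_contra h
    refine hne ⟨y, hball ?_, h⟩
    rw [ball_pi _ hr]
    exact hy

theorem isOpen_eval_ne_zero {n : ℕ} (p : MvPolynomial (Fin n) ℝ) :
    IsOpen {x : Fin n → ℝ | eval x p ≠ 0} :=
  isOpen_ne_fun (MvPolynomial.continuous_eval p) continuous_const

/-- The matrix `M(m, p, ε)`, made homogeneous with the variable `b`. -/
def homMatrix {R : Type*} [CommRing R] (w : Fin 3 → R) (e b : R) (x : Fin 6 → R) :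
    Matrix (Fin 6) (Fin 6) R :=
  !![b, 0, 0, 0, e * (w 1 - w 2) * x 5, e * (w 1 - w 2) * x 4;
     0, b, 0, e * (w 2 - w 0) * x 5, 0, e * (w 2 - w 0) * x 3;
     0, 0, b, e * (w 0 - w 1) * x 4, e * (w 0 - w 1) * x 3, 0;
     0, e * x 5, -e * x 4, b, -e * x 2, e * x 1;
     -e * x 5, 0, e * x 3, e * x 2, b, -e * x 0;
     e * x 4, -e * x 3, 0, -e * x 1, e * x 0, b]

theorem homMatrix_smul (ω : Fin 3 → ℝ) (ε b : ℝ) (x : Phase) :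
    homMatrix ω ε b (b • x) = b • clebschMatrix ω ε x := by
  ext i j
  fin_cases i <;> fin_cases j <;> simp [homMatrix, clebschMatrix] <;> ring

theorem map_homMatrix {R S : Type*} [CommRing R] [CommRing S] (g : R →+* S) (w : Fin 3 → R)
    (e b : R) (x : Fin 6 → R) :
    g.mapMatrix (homMatrix w e b x) = homMatrix (g ∘ w) (g e) (g b) (g ∘ x) := by
  ext i j
  fin_cases i <;> fin_cases j <;> simp [homMatrix]

/-- Numerators and common denominator of the iterates of the map. -/
noncomputable def iterPoly (ω : Fin 3 → ℝ) (ε : ℝ) :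
    ℕ → (Fin 6 → MvPolynomial (Fin 6) ℝ) × MvPolynomial (Fin 6) ℝ
  | 0 => (X, 1)
  | n + 1 =>
    let H := homMatrix (fun i => C (ω i)) (C ε) (iterPoly ω ε n).2 (iterPoly ω ε n).1
    (Matrix.mulVec H.adjugate (iterPoly ω ε n).1, H.det)

/-- The numerator of `det M(f^n(x, ε), δ)`. -/
noncomputable def detPoly (ω : Fin 3 → ℝ) (ε δ : ℝ) (n : ℕ) : MvPolynomial (Fin 6) ℝ :=
  (homMatrix (fun i => C (ω i)) (C δ) (iterPoly ω ε n).2 (iterPoly ω ε n).1).det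

section Iterates

variable {ω : Fin 3 → ℝ} {ε : ℝ} {x : Phase}

theorem mapMatrix_homMatrix_iterPoly {n : ℕ} (δ : ℝ) {z : Phase}
    (ha : ∀ i, eval x ((iterPoly ω ε n).1 i) = eval x (iterPoly ω ε n).2 * z i) :
    (eval x).mapMatrix (homMatrix (fun i => C (ω i)) (C δ) (iterPoly ω ε n).2 (iterPoly ω ε n).1)
      = eval x (iterPoly ω ε n).2 • clebschMatrix ω δ z := by
  rw [map_homMatrix, ← homMatrix_smul]
  congr 1
  · ext i; simp
  · simp
  · ext i; simp [ha]

theorem eval_detPoly {n : ℕ} (δ : ℝ) {z : Phase}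
    (ha : ∀ i, eval x ((iterPoly ω ε n).1 i) = eval x (iterPoly ω ε n).2 * z i) :
    eval x (detPoly ω ε δ n) = eval x (iterPoly ω ε n).2 ^ 6 * (clebschMatrix ω δ z).det := by
  rw [detPoly, RingHom.map_det, mapMatrix_homMatrix_iterPoly δ ha, Matrix.det_smul]
  simp

/-- If z = a / b, the homogenized matrix is H = b M(z), and a = b z = H f(z). Hence adj(H) a =
det(H) f(z), which is the recursion for numerators and denominator. -/
theorem eval_iterPoly {n : ℕ} (h : ∀ i < n, (clebschMap ω ε)^[i] x ∈ clebschDomain ω ε) :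
    eval x (iterPoly ω ε n).2 ≠ 0 ∧ ∀ i, eval x ((iterPoly ω ε n).1 i) =
      eval x (iterPoly ω ε n).2 * (clebschMap ω ε)^[n] x i := by
  induction n with
  | zero => simp [iterPoly]
  | succ n ih =>
    obtain ⟨hb, ha⟩ := ih fun i hi => h i (by omega)
    have hz := h n (by omega)
    rw [Function.iterate_succ_apply']
    generalize (clebschMap ω ε)^[n] x = z at *
    have hdet := eval_detPoly ε ha
    have hH := mapMatrix_homMatrix_iterPoly ε ha
    have e2 : (iterPoly ω ε (n + 1)).2 = detPoly ω ε ε n := rfl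
    have e1 : (iterPoly ω ε (n + 1)).1 = Matrix.mulVec (homMatrix (fun i => C (ω i)) (C ε)
      (iterPoly ω ε n).2 (iterPoly ω ε n).1).adjugate (iterPoly ω ε n).1 := rfl
    rw [e1, e2]
    refine ⟨by rw [hdet]; exact mul_ne_zero (pow_ne_zero _ hb) hz, fun i => ?_⟩
    have hd : eval x (detPoly ω ε ε n) =
        (eval x (iterPoly ω ε n).2 • clebschMatrix ω ε z).det := by
      rw [← hH, detPoly, RingHom.map_det]
    rw [RingHom.map_mulVec, ← RingHom.mapMatrix_apply, RingHom.map_adjugate, hH, hd]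
    have hv : (eval x ∘ (iterPoly ω ε n).1 : Phase) = Matrix.mulVec
        (eval x (iterPoly ω ε n).2 • clebschMatrix ω ε z) (clebschMap ω ε z) := by
      rw [Matrix.smul_mulVec, clebschMatrix_mulVec_clebschMap hz]
      ext j
      simp [ha]
    rw [hv, Matrix.mulVec_mulVec, Matrix.adjugate_mul, Matrix.smul_mulVec, Matrix.one_mulVec]
    rfl

theorem iterate_mem_clebschDomain (h : ∀ n, eval x (detPoly ω ε ε n) ≠ 0) (n : ℕ) :
    (clebschMap ω ε)^[n] x ∈ clebschDomain ω ε := by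
  induction n using Nat.strong_induction_on with
  | _ n ih =>
    have := h n
    rw [eval_detPoly ε (eval_iterPoly ih).2] at this
    exact right_ne_zero_of_mul this

theorem iterate_mem_clebschDomain_of_eval_ne_zero {δ : ℝ}
    (h : ∀ n, eval x (detPoly ω ε ε n) ≠ 0) {n : ℕ} (hδ : eval x (detPoly ω ε δ n) ≠ 0) :
    (clebschMap ω ε)^[n] x ∈ clebschDomain ω δ := by
  rw [eval_detPoly δ (eval_iterPoly fun i _ => iterate_mem_clebschDomain h i).2] at hδ
  exact right_ne_zero_of_mul hδ

theorem clebschMatrix_zero (ω : Fin 3 → ℝ) (ε : ℝ) : clebschMatrix ω ε 0 = 1 := by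
  ext i j
  fin_cases i <;> fin_cases j <;> simp [clebschMatrix]

/-- The origin is a fixed point with M = 1, so no denominator vanishes there. -/
theorem detPoly_ne_zero (ω : Fin 3 → ℝ) (ε δ : ℝ) (n : ℕ) : detPoly ω ε δ n ≠ 0 := by
  have hf : ∀ i, (clebschMap ω ε)^[i] 0 = 0 := fun i =>
    Function.iterate_fixed (by simp [clebschMap]) i
  have h0 : ∀ δ, (0 : Phase) ∈ clebschDomain ω δ := fun δ => by
    simp [clebschDomain, clebschMatrix_zero]
  obtain ⟨hb, ha⟩ := eval_iterPoly (ω := ω) (ε := ε) (x := 0) (n := n) fun i _ => by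
    rw [hf]; exact h0 ε
  intro h
  have := eval_detPoly δ ha
  rw [h, map_zero, hf, clebschMatrix_zero, Matrix.det_one] at this
  exact pow_ne_zero 6 hb (by linarith)

end Iterates

/-- All iterates of the map are defined on a dense set. -/
theorem dense_clebschRegular (ω : Fin 3 → ℝ) (ε : ℝ) : Dense (clebschRegular ω ε) := by
  -- Baire's theorem: the first Boolean is the direction of iteration, the second the sign of the
  -- parameter in the matrix.
  have hd : Dense (⋂ i : (ℕ × Bool) × Bool, {x : Phase | eval x (detPoly ω
      (bif i.1.2 then ε else -ε) (bif i.2 then ε else -ε) i.1.1) ≠ 0}) :=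
    dense_iInter_of_isOpen (fun i => isOpen_eval_ne_zero _)
      fun i => dense_eval_ne_zero (detPoly_ne_zero _ _ _ _)
  refine hd.mono fun x hx => ?_
  have h : ∀ (n : ℕ) (s t : Bool), eval x (detPoly ω
      (bif s then ε else -ε) (bif t then ε else -ε) n) ≠ 0 := fun n s t =>
    Set.mem_iInter.1 hx ((n, s), t)
  rintro (n | n)
  · exact ⟨iterate_mem_clebschDomain (fun n => h n true true) n,
      iterate_mem_clebschDomain_of_eval_ne_zero (fun n => h n true true) (h n true false)⟩
  -- The integer `Int.negSucc n` stands for n + 1 backward steps.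
  · exact ⟨iterate_mem_clebschDomain_of_eval_ne_zero (fun n => h n false false)
      (h (n + 1) false true), iterate_mem_clebschDomain (fun n => h n false false) (n + 1)⟩

/-! ### The dimension of the null-space -/

/-- The first five members of `Ψ`. -/
def psiFive {R : Type*} [CommRing R] (x : Fin 6 → R) : Fin 5 → R :=
  ![x 3 ^ 2, x 4 ^ 2, x 5 ^ 2, x 0 * x 3, x 1 * x 4]

/-- The numerator of the determinant of the first five members of `Ψ` at the first five points of
the forward orbit. -/
noncomputable def minorPoly (ω : Fin 3 → ℝ) (ε : ℝ) : MvPolynomial (Fin 6) ℝ :=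
  (Matrix.of fun i : Fin 5 => psiFive (iterPoly ω ε i).1).det

/-- Each row is quadratic in the orbit point, so it carries the square of that point's denominator.
Five points require four steps. -/
theorem eval_minorPoly {ω : Fin 3 → ℝ} {ε : ℝ} {x : Phase}
    (h : ∀ i < 4, (clebschMap ω ε)^[i] x ∈ clebschDomain ω ε) :
    eval x (minorPoly ω ε) = (∏ i : Fin 5, eval x (iterPoly ω ε i).2 ^ 2) *
      (Matrix.of fun i : Fin 5 => psiFive ((clebschMap ω ε)^[i] x)).det := by
  rw [← Matrix.det_mul_column, minorPoly, RingHom.map_det]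
  congr 1
  ext i j
  have ha := (eval_iterPoly (n := i) fun k hk => h k (by omega)).2
  fin_cases j <;> simp [psiFive, ha] <;> ring

theorem psiFive_det_ne_zero {ω : Fin 3 → ℝ} {ε : ℝ} {x : Phase} (hx : x ∈ clebschRegular ω ε)
    (h : eval x (minorPoly ω ε) ≠ 0) :
    (Matrix.of fun i : Fin 5 => psiFive (clebschIter ω ε (i : ℕ) x)).det ≠ 0 := by
  rw [eval_minorPoly fun i _ => (hx i).1] at h
  exact right_ne_zero_of_mul h

/-- A null-vector is thus determined by its last entry, which bounds the dimension by one. -/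
theorem eq_zero_of_mem_hkNullSpace {ω : Fin 3 → ℝ} {ε : ℝ} {x : Phase}
    (hx : x ∈ clebschRegular ω ε) (h : eval x (minorPoly ω ε) ≠ 0) {c : Fin 6 → ℝ}
    (hc : c ∈ hkNullSpace (clebschIter ω ε) clebschPsi x) (h5 : c 5 = 0) : c = 0 := by
  have h0 : (![c 0, c 1, c 2, c 3, c 4] : Fin 5 → ℝ) = 0 := by
    refine Matrix.eq_zero_of_mulVec_eq_zero (psiFive_det_ne_zero hx h) ?_
    ext i
    have := hc (i : ℕ)
    simp only [Fin.sum_univ_six, clebschPsi, Matrix.cons_val, h5, zero_mul, add_zero] at this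
    simp only [Matrix.mulVec, dotProduct, Fin.sum_univ_five, Matrix.of_apply, psiFive,
      Matrix.cons_val, Pi.zero_apply]
    linear_combination this
  ext i
  fin_cases i
  · exact congrFun h0 0
  · exact congrFun h0 1
  · exact congrFun h0 2
  · exact congrFun h0 3
  · exact congrFun h0 4
  · exact h5

theorem hkNullSpace_eq_span {ω : Fin 3 → ℝ} {ε : ℝ} {x : Phase} (hx : x ∈ clebschRegular ω ε)
    (h : eval x (minorPoly ω ε) ≠ 0) {v : Fin 6 → ℝ}
    (hv : v ∈ hkNullSpace (clebschIter ω ε) clebschPsi x) (hv0 : v 0 ≠ 0) :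
    Module.finrank ℝ (hkNullSpace (clebschIter ω ε) clebschPsi x) = 1 ∧
      hkNullSpace (clebschIter ω ε) clebschPsi x = Submodule.span ℝ {v} := by
  have hv1 : v ≠ 0 := fun h => hv0 (congrFun h 0)
  have hv5 : v 5 ≠ 0 := fun h5 => hv1 (eq_zero_of_mem_hkNullSpace hx h hv h5)
  suffices hspan : hkNullSpace (clebschIter ω ε) clebschPsi x = Submodule.span ℝ {v} from
    ⟨by rw [hspan]; exact finrank_span_singleton hv1, hspan⟩
  refine le_antisymm (fun c hc => ?_) ((Submodule.span_singleton_le_iff_mem _ _).2 hv)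
  rw [Submodule.mem_span_singleton]
  refine ⟨c 5 / v 5, ?_⟩
  have := eq_zero_of_mem_hkNullSpace hx h (Submodule.sub_mem _ (Submodule.smul_mem _ (c 5 / v 5) hv)
    hc) (by simp [hv5])
  exact sub_eq_zero.1 this

/-! ### Linearization of the map at a fixed point -/

section Linearization

open Filter Topology

variable {ω : Fin 3 → ℝ} {ε : ℝ} {z : Phase}

theorem continuous_clebschMatrix (ω : Fin 3 → ℝ) (ε : ℝ) : Continuous (clebschMatrix ω ε) := by
  refine continuous_matrix fun i j => ?_
  fin_cases i <;> fin_cases j <;> simp only [clebschMatrix, Matrix.of_apply, Matrix.cons_val,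
    Fin.zero_eta, Fin.mk_one, Fin.reduceFinMk] <;> fun_prop

theorem continuousAt_clebschMatrix_inv (hz : z ∈ clebschDomain ω ε) :
    ContinuousAt (fun x => (clebschMatrix ω ε x)⁻¹) z := by
  refine ContinuousAt.comp (f := clebschMatrix ω ε) (continuousAt_matrix_inv _ ?_)
    (continuous_clebschMatrix ω ε).continuousAt
  rw [Ring.inverse_eq_inv']
  exact continuousAt_inv₀ hz

theorem isOpen_clebschDomain (ω : Fin 3 → ℝ) (ε : ℝ) : IsOpen (clebschDomain ω ε) :=
  isOpen_ne_fun (continuous_clebschMatrix ω ε).matrix_det continuous_const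

/-- M(x, ε) y = y - ε B(x, y) with B bilinear and symmetric, so the two B-terms cancel. -/
theorem clebschMatrix_mulVec_add (ω : Fin 3 → ℝ) (ε : ℝ) (x y : Phase) :
    Matrix.mulVec (clebschMatrix ω ε x) y + Matrix.mulVec (clebschMatrix ω (-ε) y) x = x + y := by
  ext i
  fin_cases i <;>
    simp only [clebschMatrix, Matrix.mulVec, dotProduct, Fin.sum_univ_six, Matrix.of_apply,
      Matrix.cons_val, Pi.add_apply, Fin.zero_eta, Fin.mk_one, Fin.reduceFinMk] <;> ring

theorem clebschMap_eq_self (hz : z ∈ clebschDomain ω ε)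
    (hfix : Matrix.mulVec (clebschMatrix ω ε z) z = z) : clebschMap ω ε z = z := by
  rw [clebschMap]
  nth_rewrite 2 [← hfix]
  rw [Matrix.mulVec_mulVec, Matrix.nonsing_inv_mul _ (Ne.isUnit hz), Matrix.one_mulVec]

/-- The derivative of the map at a fixed point, along a curve. -/
theorem hasDerivAt_clebschMap_comp {γ : ℝ → Phase} {ξ η : Phase} (hz : z ∈ clebschDomain ω ε)
    (hfix : Matrix.mulVec (clebschMatrix ω ε z) z = z) (hγ0 : γ 0 = z) (hγ : HasDerivAt γ ξ 0)
    (hη : Matrix.mulVec (clebschMatrix ω ε z) η = Matrix.mulVec (clebschMatrix ω (-ε) z) ξ) :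
    HasDerivAt (fun t => clebschMap ω ε (γ t)) η 0 := by
  have hcont : Tendsto γ (𝓝[≠] 0) (𝓝 z) := by
    rw [← hγ0]; exact hγ.continuousAt.tendsto.mono_left nhdsWithin_le_nhds
  have hinv := (continuousAt_clebschMatrix_inv hz).tendsto.comp hcont
  rw [hasDerivAt_iff_tendsto_slope] at hγ ⊢
  have hlim : Tendsto (fun t => Matrix.mulVec (clebschMatrix ω ε (γ t))⁻¹
      (Matrix.mulVec (clebschMatrix ω (-ε) z) (slope γ 0 t))) (𝓝[≠] 0) (𝓝 η) := by
    have hc : Continuous fun q : Matrix (Fin 6) (Fin 6) ℝ × Phase =>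
        Matrix.mulVec q.1 (Matrix.mulVec (clebschMatrix ω (-ε) z) q.2) := by fun_prop
    have := (hc.tendsto _).comp (hinv.prodMk_nhds hγ)
    rwa [← hη, Matrix.mulVec_mulVec, Matrix.nonsing_inv_mul _ (Ne.isUnit hz),
      Matrix.one_mulVec] at this
  refine hlim.congr' ?_
  filter_upwards [hcont.eventually ((isOpen_clebschDomain ω ε).mem_nhds hz)] with t ht
  rw [slope, slope, hγ0, clebschMap_eq_self hz hfix]
  simp only [vsub_eq_sub, Matrix.mulVec_smul]
  congr 1
  -- This is exact, not only to first order, so continuity of M⁻¹ suffices to pass to the limit in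
  -- the difference quotient.
  have h1 : Matrix.mulVec (clebschMatrix ω (-ε) z) (γ t - z) =
      Matrix.mulVec (clebschMatrix ω ε (γ t)) (clebschMap ω ε (γ t) - z) := by
    rw [Matrix.mulVec_sub, Matrix.mulVec_sub, clebschMatrix_mulVec_clebschMap ht,
      clebschMatrix_neg_mulVec hfix]
    linear_combination clebschMatrix_mulVec_add ω ε (γ t) z
  rw [h1, Matrix.mulVec_mulVec, Matrix.nonsing_inv_mul _ (Ne.isUnit ht), Matrix.one_mulVec]

/-- The derivatives of the iterates of the map at a fixed point, along a curve. -/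
theorem hasDerivAt_iterate_clebschMap {γ : ℝ → Phase} {ξ : ℕ → Phase} (hz : z ∈ clebschDomain ω ε)
    (hfix : Matrix.mulVec (clebschMatrix ω ε z) z = z) (hγ0 : γ 0 = z) (hγ : HasDerivAt γ (ξ 0) 0)
    {n : ℕ} (hξ : ∀ i < n, Matrix.mulVec (clebschMatrix ω ε z) (ξ (i + 1)) =
      Matrix.mulVec (clebschMatrix ω (-ε) z) (ξ i)) :
    HasDerivAt (fun t => (clebschMap ω ε)^[n] (γ t)) (ξ n) 0 ∧ (clebschMap ω ε)^[n] (γ 0) = z := by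
  induction n with
  | zero => exact ⟨hγ, hγ0⟩
  | succ n ih =>
    obtain ⟨h1, h2⟩ := ih fun i hi => hξ i (by omega)
    simp only [Function.iterate_succ_apply']
    exact ⟨hasDerivAt_clebschMap_comp hz hfix h2 h1 (hξ n (by omega)),
      by rw [h2, clebschMap_eq_self hz hfix]⟩

theorem tendsto_det {n : ℕ} {α : Type*} {l : Filter α} {F : α → Matrix (Fin n) (Fin n) ℝ}
    {L : Matrix (Fin n) (Fin n) ℝ} (h : ∀ i j, Tendsto (fun t => F t i j) l (𝓝 (L i j))) :
    Tendsto (fun t => (F t).det) l (𝓝 L.det) :=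
  ((continuous_id.matrix_det (R := ℝ)).tendsto L).comp
    (tendsto_pi_nhds.2 fun i => tendsto_pi_nhds.2 fun j => h i j)

/-- If the quadratic forms in the components transversal to the `p₃`-axis are independent along
an orbit of the linearization at a point of this axis, then the determinant does not vanish
identically. -/
theorem minorPoly_ne_zero_of_linearization {a : ℝ} {ξ : ℕ → Phase}
    (hz : ![0, 0, 0, 0, 0, a] ∈ clebschDomain ω ε)
    (hξ : ∀ i < 4, Matrix.mulVec (clebschMatrix ω ε ![0, 0, 0, 0, 0, a]) (ξ (i + 1)) =
      Matrix.mulVec (clebschMatrix ω (-ε) ![0, 0, 0, 0, 0, a]) (ξ i))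
    (hdet : (Matrix.of fun i : Fin 5 => ![ξ i 3 ^ 2, ξ i 4 ^ 2, a ^ 2, ξ i 0 * ξ i 3,
      ξ i 1 * ξ i 4]).det ≠ 0) : minorPoly ω ε ≠ 0 := by
  set z : Phase := ![0, 0, 0, 0, 0, a] with hzdef
  let γ : ℝ → Phase := fun t => z + t • ξ 0
  have hγ0 : γ 0 = z := by simp [γ]
  have hγ : HasDerivAt γ (ξ 0) 0 := by
    have := ((hasDerivAt_id (0 : ℝ)).smul_const (ξ 0)).const_add z
    simpa [γ] using this
  have hfix : Matrix.mulVec (clebschMatrix ω ε z) z = z := by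
    rw [clebschMatrix_mulVec_eq_iff]
    simp [hzdef]
  have key := fun (n : ℕ) (hn : n ≤ 4) => hasDerivAt_iterate_clebschMap (n := n) hz hfix hγ0 hγ
    fun i hi => hξ i (by omega)
  let s : ℕ → ℝ → Phase := fun n t => slope (fun t => (clebschMap ω ε)^[n] (γ t)) 0 t
  have hs : ∀ n ≤ 4, Tendsto (s n) (𝓝[≠] 0) (𝓝 (ξ n)) := fun n hn =>
    hasDerivAt_iff_tendsto_slope.1 (key n hn).1
  have hX : ∀ n ≤ 4, Tendsto (fun t => (clebschMap ω ε)^[n] (γ t)) (𝓝[≠] 0) (𝓝 z) := by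
    intro n hn
    have := (key n hn).1.continuousAt.tendsto
    rw [(key n hn).2] at this
    exact this.mono_left nhdsWithin_le_nhds
  have hcoord : ∀ n ≤ 4, ∀ t ≠ 0, ∀ j, (clebschMap ω ε)^[n] (γ t) j = z j + t * s n t j := by
    intro n hn t ht j
    simp only [s, slope, (key n hn).2, vsub_eq_sub, sub_zero, Pi.smul_apply, Pi.sub_apply,
      smul_eq_mul]
    field_simp
    ring
  -- Four columns are of second order in t and are divided by t²; the column of p₃² tends to a²
  -- undivided.
  have hlim : Tendsto (fun t => (Matrix.of fun i : Fin 5 => ![s i t 3 ^ 2, s i t 4 ^ 2,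
      (clebschMap ω ε)^[i] (γ t) 5 ^ 2, s i t 0 * s i t 3, s i t 1 * s i t 4]).det)
      (𝓝[≠] 0) (𝓝 (Matrix.of fun i : Fin 5 => ![ξ i 3 ^ 2, ξ i 4 ^ 2, a ^ 2, ξ i 0 * ξ i 3,
      ξ i 1 * ξ i 4]).det) := by
    refine tendsto_det fun i j => ?_
    have hsi := fun k => (tendsto_pi_nhds.1 (hs i (by omega))) k
    have hXi := (tendsto_pi_nhds.1 (hX i (by omega))) 5
    fin_cases j
    · simpa using (hsi 3).pow 2
    · simpa using (hsi 4).pow 2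
    · simpa [hzdef] using hXi.pow 2
    · simpa using (hsi 0).mul (hsi 3)
    · simpa using (hsi 1).mul (hsi 4)
  have hdom : ∀ i ∈ Finset.range 4, ∀ᶠ t in 𝓝[≠] (0 : ℝ),
      (clebschMap ω ε)^[i] (γ t) ∈ clebschDomain ω ε := fun i hi =>
    (hX i (Finset.mem_range.1 hi).le).eventually ((isOpen_clebschDomain ω ε).mem_nhds hz)
  obtain ⟨t, ⟨h1, h2⟩, ht⟩ := (((hlim.eventually_ne hdet).and
    ((Finset.eventually_all _).2 hdom)).and self_mem_nhdsWithin).exists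
  have ht0 : t ≠ 0 := ht
  intro h0
  have h3 := eval_minorPoly (ω := ω) (ε := ε) (x := γ t)
    fun i hi => h2 i (Finset.mem_range.2 hi)
  rw [h0, map_zero] at h3
  have hprod : (∏ i : Fin 5, eval (γ t) (iterPoly ω ε i).2 ^ 2) ≠ 0 :=
    Finset.prod_ne_zero_iff.2 fun i _ => pow_ne_zero 2 (eval_iterPoly (n := i)
      fun k hk => h2 k (Finset.mem_range.2 (by omega))).1
  have h4 := (mul_eq_zero.1 h3.symm).resolve_left hprod
  have h5 : (Matrix.of fun i : Fin 5 => psiFive ((clebschMap ω ε)^[i] (γ t))) =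
      Matrix.of fun i j => (![t ^ 2, t ^ 2, 1, t ^ 2, t ^ 2] : Fin 5 → ℝ) j *
        (Matrix.of fun i : Fin 5 => ![s i t 3 ^ 2, s i t 4 ^ 2,
      (clebschMap ω ε)^[i] (γ t) 5 ^ 2, s i t 0 * s i t 3, s i t 1 * s i t 4]) i j := by
    ext i j
    have hc := hcoord i (by omega) t ht0
    have e0 := hc 0
    have e1 := hc 1
    have e3 := hc 3
    have e4 := hc 4
    simp only [hzdef, Matrix.cons_val, zero_add] at e0 e1 e3 e4
    fin_cases j <;> simp [psiFive, e0, e1, e3, e4] <;> ring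
  rw [h5, Matrix.det_mul_row] at h4
  refine h1 ((mul_eq_zero.1 h4).resolve_left ?_)
  simp [Fin.prod_univ_five, ht0]

/-- A determinant with three even and two odd columns. -/
theorem det_even_odd_ne_zero {a₀ a₁ a₂ b₀ b₁ b₂ c e₀ e₁ f₀ f₁ : ℝ} (hc : c ≠ 0)
    (hodd : e₀ * f₁ - e₁ * f₀ ≠ 0)
    (heven : (a₀ - a₂) * (b₁ - b₂) - (a₁ - a₂) * (b₀ - b₂) ≠ 0) :
    (!![a₀, b₀, c, -e₀, -f₀; a₁, b₁, c, -e₁, -f₁; a₂, b₂, c, 0, 0; a₁, b₁, c, e₁, f₁;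
      a₀, b₀, c, e₀, f₀] : Matrix (Fin 5) (Fin 5) ℝ).det ≠ 0 := by
  intro h
  obtain ⟨v, hv, hMv⟩ := Matrix.exists_mulVec_eq_zero_iff.2 h
  have h0 := congrFun hMv 0
  have h1 := congrFun hMv 1
  have h2 := congrFun hMv 2
  have h3 := congrFun hMv 3
  have h4 := congrFun hMv 4
  simp only [Matrix.mulVec, dotProduct, Fin.sum_univ_five, Matrix.of_apply, Matrix.cons_val,
    Pi.zero_apply] at h0 h1 h2 h3 h4
  -- Rows 0 and 4, and rows 1 and 3, differ only by the sign of the odd columns: differences isolate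
  -- the odd part, sums the even part.
  have v3 : v 3 = 0 := mul_left_cancel₀ hodd
    (by linear_combination (f₁ * (h4 - h0) - f₀ * (h3 - h1)) / 2)
  have v4 : v 4 = 0 := mul_left_cancel₀ hodd
    (by linear_combination (e₀ * (h3 - h1) - e₁ * (h4 - h0)) / 2)
  have v0 : v 0 = 0 := mul_left_cancel₀ heven
    (by linear_combination (b₁ - b₂) * ((h4 + h0) / 2 - h2) - (b₀ - b₂) * ((h3 + h1) / 2 - h2))
  have v1 : v 1 = 0 := mul_left_cancel₀ heven
    (by linear_combination (a₀ - a₂) * ((h3 + h1) / 2 - h2) - (a₁ - a₂) * ((h4 + h0) / 2 - h2))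
  have v2 : v 2 = 0 := mul_left_cancel₀ hc (by linear_combination h2 - a₂ * v0 - b₂ * v1)
  apply hv
  ext i
  fin_cases i
  exacts [v0, v1, v2, v3, v4]

/-- The cosine-like components of an explicit orbit of the linearization. -/
noncomputable def linCos (u : ℝ) : ℕ → ℝ
  | 0 => 2 * (1 - u) ^ 2 - (1 + u) ^ 2
  | 1 => (1 - u) * (1 + u)
  | 2 => (1 + u) ^ 2
  | 3 => (1 - u) * (1 + u)
  | _ => 2 * (1 - u) ^ 2 - (1 + u) ^ 2

/-- The sine-like components of an explicit orbit of the linearization. -/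
noncomputable def linSin (u : ℝ) : ℕ → ℝ
  | 0 => -(4 * (1 - u))
  | 1 => -(2 * (1 + u))
  | 2 => 0
  | 3 => 2 * (1 + u)
  | _ => 4 * (1 - u)

/-- For u > 0, c + i√u s is multiplied in each step by (1 + i√u) / (1 - i√u). The orbit is
normalized to (1 + u)² at index 2, which clears denominators and makes c even and s odd about the
middle; the resulting identities are polynomial in u. -/
theorem linCos_succ (u : ℝ) {i : ℕ} (hi : i < 4) :
    linCos u (i + 1) - linCos u i = -(u * (linSin u (i + 1) + linSin u i)) := by
  interval_cases i <;> simp only [linCos, linSin] <;> ring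

theorem linSin_succ (u : ℝ) {i : ℕ} (hi : i < 4) :
    linSin u (i + 1) - linSin u i = linCos u (i + 1) + linCos u i := by
  interval_cases i <;> simp only [linCos, linSin] <;> ring

theorem minorPoly_ne_zero (hω : Function.Injective ω) (hε : ε ≠ 0) : minorPoly ω ε ≠ 0 := by
  have hA : ω 0 - ω 2 ≠ 0 := sub_ne_zero.2 (hω.ne (by decide))
  have hB : ω 1 - ω 2 ≠ 0 := sub_ne_zero.2 (hω.ne (by decide))
  have hAB : ω 0 - ω 1 ≠ 0 := sub_ne_zero.2 (hω.ne (by decide))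
  -- For small a the factors 1 + u, 1 + v and 1 - uv of the determinants below are nonzero.
  obtain ⟨a, ha, hu, hv⟩ : ∃ a : ℝ, a ≠ 0 ∧ |(ε * a) ^ 2 * (ω 0 - ω 2)| < 1 ∧
      |(ε * a) ^ 2 * (ω 1 - ω 2)| < 1 := by
    have hc : ∀ r : ℝ, ∀ᶠ a in 𝓝[≠] (0 : ℝ), |(ε * a) ^ 2 * r| < 1 := by
      intro r
      have h : ContinuousAt (fun a : ℝ => |(ε * a) ^ 2 * r|) 0 := by fun_prop
      refine (h.eventually_lt continuousAt_const ?_).filter_mono nhdsWithin_le_nhds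
      simp
    obtain ⟨a, h, ha⟩ := (((hc (ω 0 - ω 2)).and (hc (ω 1 - ω 2))).and
      self_mem_nhdsWithin).exists
    exact ⟨a, ha, h.1, h.2⟩
  set u := (ε * a) ^ 2 * (ω 0 - ω 2) with hudef
  set v := (ε * a) ^ 2 * (ω 1 - ω 2) with hvdef
  have hεa : (ε * a) ^ 2 ≠ 0 := pow_ne_zero _ (mul_ne_zero hε ha)
  have hu0 : u ≠ 0 := mul_ne_zero hεa hA
  have hv0 : v ≠ 0 := mul_ne_zero hεa hB
  have huv : u - v ≠ 0 := by
    have : u - v = (ε * a) ^ 2 * (ω 0 - ω 1) := by rw [hudef, hvdef]; ring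
    rw [this]
    exact mul_ne_zero hεa hAB
  have hu1 : 1 + u ≠ 0 := by linarith [(abs_lt.1 hu).1]
  have hv1 : 1 + v ≠ 0 := by linarith [(abs_lt.1 hv).1]
  have huv1 : 1 - u * v ≠ 0 := by
    have h1 : |u * v| < 1 := by
      rw [abs_mul]
      exact mul_lt_one_of_nonneg_of_lt_one_left (abs_nonneg u) hu hv.le
    linarith [(abs_lt.1 h1).2]
  -- At this fixed point the linearization couples m₂ with p₁ (parameter u) and m₁ with p₂
  -- (parameter v).
  refine minorPoly_ne_zero_of_linearization (a := a) (ξ := fun i =>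
    ![-(ε * a * (ω 1 - ω 2) * linSin v i), ε * a * (ω 0 - ω 2) * linSin u i, 0,
      linCos u i, linCos v i, 0]) ?_ (fun i hi => ?_) ?_
  · intro hdet
    obtain ⟨V, hV, hMV⟩ := Matrix.exists_mulVec_eq_zero_iff.2 hdet
    have h0 := congrFun hMV 0
    have h1 := congrFun hMV 1
    have h2 := congrFun hMV 2
    have h3 := congrFun hMV 3
    have h4 := congrFun hMV 4
    have h5 := congrFun hMV 5
    simp only [clebschMatrix, Matrix.mulVec, dotProduct, Fin.sum_univ_six, Matrix.of_apply,
      Matrix.cons_val, Pi.zero_apply] at h0 h1 h2 h3 h4 h5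
    have e3 : V 3 = 0 := mul_left_cancel₀ hu1
      (by rw [hudef]; linear_combination h3 - ε * a * h1)
    have e4 : V 4 = 0 := mul_left_cancel₀ hv1
      (by rw [hvdef]; linear_combination h4 + ε * a * h0)
    apply hV
    ext i
    fin_cases i
    · simpa [e4] using h0
    · simpa [e3] using h1
    · simpa using h2
    · exact e3
    · exact e4
    · simpa using h5
  · have c1 := linCos_succ u hi
    have c2 := linCos_succ v hi
    have s1 := linSin_succ u hi
    have s2 := linSin_succ v hi
    generalize linCos u i = c at *
    generalize linCos v i = c' at *
    generalize linSin u i = s at *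
    generalize linSin v i = s' at *
    generalize linCos u (i + 1) = d at *
    generalize linCos v (i + 1) = d' at *
    generalize linSin u (i + 1) = t at *
    generalize linSin v (i + 1) = t' at *
    rw [hudef] at c1
    rw [hvdef] at c2
    ext j
    fin_cases j <;>
      simp only [clebschMatrix, Matrix.mulVec, dotProduct, Fin.sum_univ_six, Matrix.of_apply,
        Matrix.cons_val, Fin.zero_eta, Fin.mk_one, Fin.reduceFinMk]
    · linear_combination -(ε * a * (ω 1 - ω 2)) * s2
    · linear_combination (ε * a * (ω 0 - ω 2)) * s1
    · ring
    · linear_combination c1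
    · linear_combination c2
    · ring
  · have hodd : -(ε * a * (ω 1 - ω 2)) * (4 * (1 - v)) * (2 * (1 - u) ^ 2 - (1 + u) ^ 2) *
        (ε * a * (ω 0 - ω 2) * (2 * (1 + u)) * ((1 - v) * (1 + v))) -
        -(ε * a * (ω 1 - ω 2)) * (2 * (1 + v)) * ((1 - u) * (1 + u)) *
        (ε * a * (ω 0 - ω 2) * (4 * (1 - u)) * (2 * (1 - v) ^ 2 - (1 + v) ^ 2)) ≠ 0 := by
      have : ∀ α β : ℝ, -α * (4 * (1 - v)) * (2 * (1 - u) ^ 2 - (1 + u) ^ 2) *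
        (β * (2 * (1 + u)) * ((1 - v) * (1 + v))) -
        -α * (2 * (1 + v)) * ((1 - u) * (1 + u)) *
        (β * (4 * (1 - u)) * (2 * (1 - v) ^ 2 - (1 + v) ^ 2)) =
        32 * α * β * (1 + u) * (1 + v) * (u - v) * (1 - u * v) := by
        intro α β; ring
      rw [this]
      positivity
    have heven : ((2 * (1 - u) ^ 2 - (1 + u) ^ 2) ^ 2 - ((1 + u) ^ 2) ^ 2) *
        (((1 - v) * (1 + v)) ^ 2 - ((1 + v) ^ 2) ^ 2) -
        (((1 - u) * (1 + u)) ^ 2 - ((1 + u) ^ 2) ^ 2) *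
        ((2 * (1 - v) ^ 2 - (1 + v) ^ 2) ^ 2 - ((1 + v) ^ 2) ^ 2) ≠ 0 := by
      have : ((2 * (1 - u) ^ 2 - (1 + u) ^ 2) ^ 2 - ((1 + u) ^ 2) ^ 2) *
        (((1 - v) * (1 + v)) ^ 2 - ((1 + v) ^ 2) ^ 2) -
        (((1 - u) * (1 + u)) ^ 2 - ((1 + u) ^ 2) ^ 2) *
        ((2 * (1 - v) ^ 2 - (1 + v) ^ 2) ^ 2 - ((1 + v) ^ 2) ^ 2) =
        256 * u * v * (v - u) * (1 - u * v) := by ring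
      rw [this]
      exact mul_ne_zero (mul_ne_zero (by positivity) (by rwa [← neg_sub, neg_ne_zero])) huv1
    convert det_even_odd_ne_zero (pow_ne_zero 2 ha) hodd heven using 2
    ext i j
    fin_cases i <;> fin_cases j <;> simp [linCos, linSin]

end Linearization

/-! ### The denominator and the numerators as polynomials -/

/-- The numerator of `d_k` as a polynomial. -/
noncomputable def numPoly (ω : Fin 3 → ℝ) (ε : ℝ) (k : Fin 3) : MvPolynomial (Fin 6) ℝ :=
  pSq X * (1 + C (ε ^ 2) * (kapTrace (fun i => C (ω i)) X + mSq X + pOmega (fun i => C (ω i)) X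
    - C (ω k) * pSq X) + C (ε ^ 4) * num4Poly ω k + C (ε ^ 6) * num6Poly ω k)

/-- The denominator of `d_k` as a polynomial. -/
noncomputable def denPoly (ω : Fin 3 → ℝ) (ε : ℝ) : MvPolynomial (Fin 6) ℝ :=
  mDotP X * (1 + C (ε ^ 2) * (kapTrace (fun i => C (ω i)) X + mSq X + pOmega (fun i => C (ω i)) X))
    - C (ε ^ 2) * (mOmegaP (fun i => C (ω i)) X * pSq X)
    + C (ε ^ 4) * den6Poly ω + C (ε ^ 6) * den8Poly ω

theorem eval_numPoly (ω : Fin 3 → ℝ) (ε : ℝ) (k : Fin 3) (x : Phase) :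
    eval x (numPoly ω ε k) = pSq x * clebschNum ω ε k x := by
  simp only [numPoly, map_mul, map_add, map_sub, map_one, eval_num4Poly, eval_num6Poly, eval_C]
  rw [clebschNum_affine, num4, num6]
  simp only [kapTrace, kap, mSq, pSq, pOmega, map_mul, map_add, map_sub, map_pow, eval_X, eval_C]
  ring

theorem eval_denPoly (ω : Fin 3 → ℝ) (ε : ℝ) (x : Phase) :
    eval x (denPoly ω ε) = clebschDen ω ε x := by
  simp only [denPoly, map_mul, map_add, map_sub, map_one, eval_den6Poly, eval_den8Poly, eval_C]
  simp only [clebschDen, clebschNum_affine, den6, den8, num4, num6]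
  simp only [mDotP, mOmegaP, kapTrace, kap, mSq, pSq, pOmega, map_mul, map_add, map_sub, map_pow,
    eval_X, eval_C]
  ring

/-- The numerators on a slice of the phase space. -/
theorem clebschNum_slice (ω : Fin 3 → ℝ) (ε m n a : ℝ) (k : Fin 3) :
    clebschNum ω ε k ![m, 0, n, 0, 0, a] =
      ((1 + (ε * a) ^ 2 * (ω 0 - ω 2)) * (1 + (ε * a) ^ 2 * (ω 1 - ω 2)) + ε ^ 2 * n ^ 2
        + ε ^ 2 * (1 + (ε * a) ^ 2 * (ω 0 - ω 2)) * m ^ 2)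
      - (ω k - ω 2) * (ε * a) ^ 2 *
      ((1 + (ε * a) ^ 2 * (ω 0 - ω 2)) * (1 + (ε * a) ^ 2 * (ω 1 - ω 2)) + ε ^ 2 * n ^ 2
        - ε ^ 2 * (1 + (ε * a) ^ 2 * (ω 0 - ω 2)) * m ^ 2) := by
  rw [clebschNum_affine]
  simp only [numA4, numB4, numA6, numB6, kapMinors, quartic, crossSq, kapTrace, kap, mKapP, pSq,
    mSq, mDotP, mOmegaP, pOmega, Matrix.cons_val]
  ring

/-- Only m₃p₃ survives, with the numerator whose ω-term is zero. Hence on the slice d_k = (a / n) (1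
- (ω_k - ω₃) (εa)² (P - Q m²) / (P + Q m²)), where P depends on n but not on m and Q on neither. -/
theorem clebschDen_slice (ω : Fin 3 → ℝ) (ε m n a : ℝ) :
    clebschDen ω ε ![m, 0, n, 0, 0, a] = n * a *
      ((1 + (ε * a) ^ 2 * (ω 0 - ω 2)) * (1 + (ε * a) ^ 2 * (ω 1 - ω 2)) + ε ^ 2 * n ^ 2
        + ε ^ 2 * (1 + (ε * a) ^ 2 * (ω 0 - ω 2)) * m ^ 2) := by
  simp only [clebschDen, clebschNum_slice, Matrix.cons_val]
  ring

/-- Near the origin the coefficients in the slice formulas are positive. -/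
theorem exists_slice_height (ω : Fin 3 → ℝ) (ε : ℝ) : ∃ a : ℝ, a ≠ 0 ∧
    0 < 1 + (ε * a) ^ 2 * (ω 0 - ω 2) ∧ 0 < 1 + (ε * a) ^ 2 * (ω 1 - ω 2) ∧
    0 < 1 + (ε * a) ^ 2 * -ω 2 := by
  have hc : ∀ r : ℝ, ∀ᶠ a in nhdsWithin (0 : ℝ) {0}ᶜ, 0 < 1 + (ε * a) ^ 2 * r := by
    intro r
    have h : ContinuousAt (fun a : ℝ => 1 + (ε * a) ^ 2 * r) 0 := by fun_prop
    refine (continuousAt_const.eventually_lt h ?_).filter_mono nhdsWithin_le_nhds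
    simp
  obtain ⟨a, ⟨⟨h1, h2⟩, h3⟩, ha⟩ := ((((hc (ω 0 - ω 2)).and (hc (ω 1 - ω 2))).and
    (hc (-ω 2))).and self_mem_nhdsWithin).exists
  exact ⟨a, ha, h1, h2, h3⟩

theorem denPoly_ne_zero (ω : Fin 3 → ℝ) (ε : ℝ) : denPoly ω ε ≠ 0 := by
  obtain ⟨a, ha, h1, h2, -⟩ := exists_slice_height ω ε
  intro h
  have h0 := eval_denPoly ω ε ![0, 0, 1, 0, 0, a]
  rw [h, map_zero, clebschDen_slice] at h0
  refine absurd h0.symm (mul_ne_zero (by simpa using ha) (ne_of_gt ?_))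
  positivity

/-! ### Functional independence of rational functions -/

theorem hasFDerivAt_eval {n : ℕ} (p : MvPolynomial (Fin n) ℝ) (x : Fin n → ℝ) :
    HasFDerivAt (fun y => eval y p)
      (∑ i, eval x (pderiv i p) • ContinuousLinearMap.proj (R := ℝ) (φ := fun _ => ℝ) i) x := by
  induction p using MvPolynomial.induction_on with
  | C a => simpa using hasFDerivAt_const a x
  | add p q hp hq =>
    simp only [map_add, add_smul, Finset.sum_add_distrib]
    exact hp.add hq
  | mul_X p i hp =>
    simp only [map_mul, eval_X]
    refine (hp.fun_mul (hasFDerivAt_apply (𝕜 := ℝ) i x)).congr_fderiv ?_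
    ext v
    simp [pderiv_X, sum_apply, add_mul, Finset.sum_add_distrib, Finset.mul_sum, Pi.single_apply,
      mul_assoc, apply_ite (eval x)]

theorem fderiv_eval_single {n : ℕ} (p : MvPolynomial (Fin n) ℝ) (x : Fin n → ℝ) (j : Fin n) :
    fderiv ℝ (fun y => eval y p) x (Pi.single j 1) = eval x (pderiv j p) := by
  rw [(hasFDerivAt_eval p x).fderiv]
  simp [Pi.single_apply]

theorem differentiableAt_eval_div {n : ℕ} {p q : MvPolynomial (Fin n) ℝ} {x : Fin n → ℝ}
    (hq : eval x q ≠ 0) : DifferentiableAt ℝ (fun y => eval y p / eval y q) x := by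
  have h1 := (hasFDerivAt_eval p x).differentiableAt
  have h2 := (hasFDerivAt_eval q x).differentiableAt
  simpa only [div_eq_mul_inv] using h1.fun_mul (h2.fun_inv hq)

/-- The quotient rule without denominators, from differentiating (p / q) q = p near x; it makes
Jacobian minors polynomial up to nonzero factors. -/
theorem fderiv_eval_div_single {n : ℕ} {p q : MvPolynomial (Fin n) ℝ} {x : Fin n → ℝ}
    (hq : eval x q ≠ 0) (j : Fin n) :
    eval x (q * pderiv j p - p * pderiv j q) =
      eval x q ^ 2 * fderiv ℝ (fun y => eval y p / eval y q) x (Pi.single j 1) := by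
  have h := (differentiableAt_eval_div (p := p) hq).hasFDerivAt.fun_mul (hasFDerivAt_eval q x)
  have he : (fun y => eval y p / eval y q * eval y q) =ᶠ[nhds x] fun y => eval y p := by
    filter_upwards [(isOpen_eval_ne_zero q).mem_nhds hq] with y hy
    exact div_mul_cancel₀ _ hy
  have h1 := congrArg (fun L : (Fin n → ℝ) →L[ℝ] ℝ => L (Pi.single j 1))
    ((h.congr_of_eventuallyEq he.symm).unique (hasFDerivAt_eval p x))
  simp only [← (hasFDerivAt_eval q x).fderiv, ← (hasFDerivAt_eval p x).fderiv, add_apply,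
    smul_apply, fderiv_eval_single, smul_eq_mul] at h1
  simp only [map_sub, map_mul]
  field_simp at h1
  linear_combination -h1

/-- Rational functions are functionally independent if their differentials are linearly
independent at one point. -/
theorem functionallyIndependent_of_point {n : ℕ} {g : Fin n → Phase → ℝ}
    {p q : Fin n → MvPolynomial (Fin 6) ℝ} (hg : ∀ i, g i = fun x => eval x (p i) / eval x (q i))
    (σ : Fin n → Fin 6) {x₀ : Phase} (hq : ∀ i, eval x₀ (q i) ≠ 0)
    (hind : ∀ c : Fin n → ℝ,
      (∀ j, HasDerivAt (fun t : ℝ => ∑ i, c i * g i (x₀ + t • Pi.single (σ j) 1)) 0 0) → c = 0) :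
    FunctionallyIndependent g := by
  let W : MvPolynomial (Fin 6) ℝ := (Matrix.of fun i j : Fin n =>
    q i * pderiv (σ j) (p i) - p i * pderiv (σ j) (q i)).det
  have hW : ∀ x, (∀ i, eval x (q i) ≠ 0) → eval x W = (∏ i, eval x (q i) ^ 2) *
      (Matrix.of fun i j : Fin n => fderiv ℝ (g i) x (Pi.single (σ j) 1)).det := by
    intro x hx
    rw [← Matrix.det_mul_column, RingHom.map_det]
    congr 1
    ext i j
    simp only [RingHom.mapMatrix_apply, Matrix.map_apply, Matrix.of_apply, hg]
    exact fderiv_eval_div_single (hx i) _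
  have hdiff : ∀ x, (∀ i, eval x (q i) ≠ 0) → ∀ i, DifferentiableAt ℝ (g i) x := by
    intro x hx i
    rw [hg]
    exact differentiableAt_eval_div (hx i)
  -- The extra factor keeps the denominators nonzero on the dense open set as well.
  have hW0 : W * ∏ i, q i ≠ 0 := by
    intro h
    have h1 : eval x₀ W * ∏ i, eval x₀ (q i) = 0 := by
      rw [← map_prod, ← map_mul, h, map_zero]
    rw [hW x₀ hq] at h1
    have h2 := (mul_eq_zero.1 ((mul_eq_zero.1 h1).resolve_right
      (Finset.prod_ne_zero_iff.2 fun i _ => hq i))).resolve_left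
      (Finset.prod_ne_zero_iff.2 fun i _ => pow_ne_zero 2 (hq i))
    obtain ⟨c, hc, hc0⟩ := Matrix.exists_vecMul_eq_zero_iff.2 h2
    refine hc (hind c fun j => ?_)
    have hsum : HasFDerivAt (fun x => ∑ i, c i * g i x) (∑ i, c i • fderiv ℝ (g i) x₀) x₀ :=
      HasFDerivAt.fun_sum fun i _ => (hdiff x₀ hq i).hasFDerivAt.const_mul (c i)
    have hline := hsum.hasLineDerivAt (Pi.single (σ j) 1)
    have hj := congrFun hc0 j
    simp only [Matrix.vecMul, dotProduct, Matrix.of_apply, Pi.zero_apply] at hj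
    simpa [HasLineDerivAt, sum_apply, hj] using hline
  refine ⟨{x | eval x (W * ∏ i, q i) ≠ 0}, isOpen_eval_ne_zero _, dense_eval_ne_zero hW0,
    fun x hx => ?_⟩
  have hx' : eval x W * ∏ i, eval x (q i) ≠ 0 := by
    rw [← map_prod, ← map_mul]; exact hx
  have hqx : ∀ i, eval x (q i) ≠ 0 := fun i =>
    Finset.prod_ne_zero_iff.1 (right_ne_zero_of_mul hx') i (Finset.mem_univ i)
  refine ⟨hdiff x hqx, ?_⟩
  have hdet := left_ne_zero_of_mul hx'
  rw [hW x hqx] at hdet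
  rw [Fintype.linearIndependent_iff]
  intro c hc
  have h0 : c = 0 := by
    refine Matrix.eq_zero_of_vecMul_eq_zero (right_ne_zero_of_mul hdet) ?_
    ext j
    have := congrArg (fun L : Phase →L[ℝ] ℝ => L (Pi.single (σ j) 1)) hc
    simpa [Matrix.vecMul, dotProduct, sum_apply] using this
  exact congrFun h0

theorem FunctionallyIndependent.comp {n k : ℕ} {g : Fin n → Phase → ℝ}
    (h : FunctionallyIndependent g) {s : Fin k → Fin n} (hs : Function.Injective s) :
    FunctionallyIndependent (g ∘ s) := by
  obtain ⟨U, hU, hd, hx⟩ := h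
  exact ⟨U, hU, hd, fun x hxU => ⟨fun i => (hx x hxU).1 (s i), (hx x hxU).2.comp s hs⟩⟩

/-- The derivative in the `m₁`-direction of the ratio in the slice formulas. -/
theorem hasDerivAt_slice_ratio {P Q : ℝ} (hPQ : P + Q ≠ 0) (A E : ℝ) :
    HasDerivAt (fun t : ℝ => A + E * ((P - Q * (1 + t) ^ 2) / (P + Q * (1 + t) ^ 2)))
      (-(4 * E * P * Q) / (P + Q) ^ 2) 0 := by
  have hs : HasDerivAt (fun t : ℝ => Q * (1 + t) ^ 2) (2 * Q) 0 := by
    have := (((hasDerivAt_id (0 : ℝ)).const_add 1).pow 2).const_mul Q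
    convert! this using 1
    simp; ring
  have h0 : P + Q * (1 + (0 : ℝ)) ^ 2 ≠ 0 := by simpa using hPQ
  have h := (((hs.const_sub P).fun_div (hs.const_add P) h0).const_mul E).const_add A
  convert! h using 1
  simp only [add_zero, one_pow, mul_one]
  field_simp
  ring

/-- At (1, 0, 1, 0, 0, a) the directions m₁, m₃, p₃ suffice: `J` depends on p only, and the slice
formulas make the Jacobian conditions solvable one after the other. -/
theorem functionallyIndependent_clebschD_clebschJ {ω : Fin 3 → ℝ} {ε : ℝ}
    (hω : Function.Injective ω) (hε : ε ≠ 0) {k l : Fin 3} (hkl : k ≠ l) :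
    FunctionallyIndependent
      ![clebschD ω (num4Poly ω) (num6Poly ω) (den6Poly ω) (den8Poly ω) ε k,
        clebschD ω (num4Poly ω) (num6Poly ω) (den6Poly ω) (den8Poly ω) ε l, clebschJ ω ε] := by
  obtain ⟨a, ha, h1, h2, h3⟩ := exists_slice_height ω ε
  have hd : ∀ k, clebschD ω (num4Poly ω) (num6Poly ω) (den6Poly ω) (den8Poly ω) ε k =
      fun x => eval x (numPoly ω ε k) / eval x (denPoly ω ε) := by
    intro k
    funext x
    rw [clebschD_eq, eval_numPoly, eval_denPoly]
  have hJ : clebschJ ω ε = fun x => eval x (pSq X : MvPolynomial (Fin 6) ℝ) /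
      eval x (1 - C (ε ^ 2) * pOmega (fun i => C (ω i)) X) := by
    funext x
    simp [clebschJ, pSq, pOmega]
  refine functionallyIndependent_of_point
    (p := ![numPoly ω ε k, numPoly ω ε l, pSq X])
    (q := ![denPoly ω ε, denPoly ω ε, 1 - C (ε ^ 2) * pOmega (fun i => C (ω i)) X])
    (fun i => ?_) ![0, 2, 5] (x₀ := ![1, 0, 1, 0, 0, a]) (fun i => ?_) (fun c hc => ?_)
  · fin_cases i
    exacts [hd k, hd l, hJ]
  · have hden : eval ![1, 0, 1, 0, 0, a] (denPoly ω ε) ≠ 0 := by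
      rw [eval_denPoly, clebschDen_slice]
      refine mul_ne_zero (by simpa using ha) (ne_of_gt ?_)
      positivity
    fin_cases i
    · exact hden
    · exact hden
    · simp [pOmega]
      intro h
      nlinarith
  · have e0 := hc 0
    have e1 := hc 1
    have e2 := hc 2
    have s0 : ∀ t : ℝ, (![1, 0, 1, 0, 0, a] + t • Pi.single 0 1 : Phase) =
        ![1 + t, 0, 1, 0, 0, a] := by
      intro t; ext i; fin_cases i <;> simp
    have s1 : ∀ t : ℝ, (![1, 0, 1, 0, 0, a] + t • Pi.single 2 1 : Phase) =
        ![1, 0, 1 + t, 0, 0, a] := by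
      intro t; ext i; fin_cases i <;> simp
    have s2 : ∀ t : ℝ, (![1, 0, 1, 0, 0, a] + t • Pi.single 5 1 : Phase) =
        ![1, 0, 1, 0, 0, a + t] := by
      intro t; ext i; fin_cases i <;> simp
    simp only [Fin.sum_univ_three, Matrix.cons_val, s0, s1, s2] at e0 e1 e2
    set K := 1 + (ε * a) ^ 2 * (ω 0 - ω 2) with hK
    set K' := 1 + (ε * a) ^ 2 * (ω 1 - ω 2) with hK'
    have hPQ : K * K' + ε ^ 2 + ε ^ 2 * K ≠ 0 := by positivity
    -- In the m₁-direction only the ratio (P - Q m₁²) / (P + Q m₁²) varies, and its derivative is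
    -- nonzero.
    have hE : c 0 * (ω k - ω 2) + c 1 * (ω l - ω 2) = 0 := by
      have hr := hasDerivAt_slice_ratio (P := K * K' + ε ^ 2) (Q := ε ^ 2 * K) hPQ
        ((c 0 + c 1) * a + c 2 * clebschJ ω ε ![1, 0, 1, 0, 0, a])
        (-((c 0 * (ω k - ω 2) + c 1 * (ω l - ω 2)) * (ε * a) ^ 2 * a))
      have hu := hr.unique (e0.congr_of_eventuallyEq (Filter.Eventually.of_forall fun t => ?_))
      · rw [div_eq_zero_iff, or_iff_left (pow_ne_zero 2 hPQ)] at hu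
        have hne : 4 * (ε * a) ^ 2 * a * (K * K' + ε ^ 2) * (ε ^ 2 * K) ≠ 0 := by positivity
        refine (mul_eq_zero.1 (?_ : 4 * (ε * a) ^ 2 * a * (K * K' + ε ^ 2) * (ε ^ 2 * K) *
          (c 0 * (ω k - ω 2) + c 1 * (ω l - ω 2)) = 0)).resolve_left hne
        linear_combination hu
      · have hpos : K * K' + ε ^ 2 + ε ^ 2 * K * (1 + t) ^ 2 ≠ 0 := by positivity
        simp only [clebschD_eq, clebschNum_slice, clebschDen_slice, ← hK, ← hK']
        simp only [clebschJ, pSq, Matrix.cons_val]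
        field_simp
        ring
    -- By `hE` the ratio drops out of the combination, leaving (c₀ + c₁) a / m₃ and a constant.
    have hsum : c 0 + c 1 = 0 := by
      have hr : HasDerivAt (fun t : ℝ => (c 0 + c 1) * a * (1 + t)⁻¹
          + c 2 * clebschJ ω ε ![1, 0, 1, 0, 0, a]) (-((c 0 + c 1) * a)) 0 := by
        have h := (((((hasDerivAt_id (0 : ℝ)).const_add 1).fun_inv (by simp)).const_mul
          ((c 0 + c 1) * a)).add_const (c 2 * clebschJ ω ε ![1, 0, 1, 0, 0, a]))
        convert! h using 1
        simp
      have hnear : ∀ᶠ t : ℝ in nhds 0, 1 + t ≠ 0 :=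
        (continuous_const.add continuous_id).continuousAt.eventually_ne (by simp)
      have hu := hr.unique (e1.congr_of_eventuallyEq ?_)
      · exact (mul_eq_zero.1 (neg_eq_zero.1 hu)).resolve_right ha
      · filter_upwards [hnear] with t ht
        have hpos : K * K' + ε ^ 2 * (1 + t) ^ 2 + ε ^ 2 * K ≠ 0 := by positivity
        simp only [clebschD_eq, clebschNum_slice, clebschDen_slice, ← hK, ← hK', one_pow, mul_one]
        simp only [clebschJ, pSq, Matrix.cons_val]
        field_simp
        linear_combination a ^ 4 * ε ^ 2 * (K * K' + (1 + t) ^ 2 * ε ^ 2 - ε ^ 2 * K) * hE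
    have hc0 : c 0 = 0 := by
      refine (mul_eq_zero.1 (?_ : (ω k - ω l) * c 0 = 0)).resolve_left
        (sub_ne_zero.2 (hω.ne hkl))
      linear_combination hE - (ω l - ω 2) * hsum
    have hc1 : c 1 = 0 := by linarith
    have hc2 : c 2 = 0 := by
      have hγ : 1 - ε ^ 2 * ω 2 * a ^ 2 ≠ 0 := by
        have : 1 - ε ^ 2 * ω 2 * a ^ 2 = 1 + (ε * a) ^ 2 * -ω 2 := by ring
        rw [this]; exact h3.ne'
      have hs : HasDerivAt (fun t : ℝ => (a + t) ^ 2) (2 * a) 0 := by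
        have := ((hasDerivAt_id (0 : ℝ)).const_add a).pow 2
        convert! this using 1
        simp
      have hr := (hs.fun_div ((hs.const_mul (ε ^ 2 * ω 2)).const_sub 1)
        (by simpa using hγ)).const_mul (c 2)
      have hu := hr.unique (e2.congr_of_eventuallyEq (Filter.Eventually.of_forall fun t => ?_))
      · have hne : 2 * a ≠ 0 := by positivity
        rw [mul_eq_zero] at hu
        refine hu.resolve_right ?_
        simp only [add_zero]
        refine div_ne_zero ?_ (pow_ne_zero 2 hγ)
        convert hne using 1
        ring
      · simp only [hc0, hc1, clebschJ, Matrix.cons_val]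
        ring
    ext i
    fin_cases i
    exacts [hc0, hc1, hc2]

theorem mainTheorem4 (ω : Fin 3 → ℝ) (hω : Function.Injective ω) :
    -- the homogeneous polynomials depend on the parameters `ω` only, not on `ε`
    ∃ (d4 d6 : Fin 3 → MvPolynomial (Fin 6) ℝ) (Δ6 Δ8 : MvPolynomial (Fin 6) ℝ),
      (∀ k, (d4 k).IsHomogeneous 4) ∧ (∀ k, (d6 k).IsHomogeneous 6) ∧
      Δ6.IsHomogeneous 6 ∧ Δ8.IsHomogeneous 8 ∧
      ∀ ε : ℝ, ε ≠ 0 →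
        -- all iterates of the map are defined on a dense set
        Dense (clebschRegular ω ε) ∧
        -- `Ψ` is a Hirota-Kimura basis
        IsHKBasis (clebschIter ω ε) (clebschRegular ω ε) clebschPsi ∧
        -- `[-1 : -1 : -1 : d₇ : d₈ : d₉]` lies in the null-space wherever it is defined
        (∀ x ∈ clebschRegular ω ε, clebschDelta ω Δ6 Δ8 ε x ≠ 0 →
          ![-1, -1, -1, clebschD ω d4 d6 Δ6 Δ8 ε 0 x, clebschD ω d4 d6 Δ6 Δ8 ε 1 x,
            clebschD ω d4 d6 Δ6 Δ8 ε 2 x] ∈ hkNullSpace (clebschIter ω ε) clebschPsi x) ∧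
        -- and outside a proper algebraic subset the null-space is the line spanned by it
        (∃ Q : MvPolynomial (Fin 6) ℝ, Q ≠ 0 ∧
          ∀ x ∈ clebschRegular ω ε, MvPolynomial.eval x Q ≠ 0 →
            clebschDelta ω Δ6 Δ8 ε x ≠ 0 ∧
            Module.finrank ℝ (hkNullSpace (clebschIter ω ε) clebschPsi x) = 1 ∧
            hkNullSpace (clebschIter ω ε) clebschPsi x =
              Submodule.span ℝ {![-1, -1, -1, clebschD ω d4 d6 Δ6 Δ8 ε 0 x,
                clebschD ω d4 d6 Δ6 Δ8 ε 1 x, clebschD ω d4 d6 Δ6 Δ8 ε 2 x]}) ∧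
        -- `d₇, d₈, d₉` are integrals of the map
        (∀ k, IsIntegralOfMotion (clebschMap ω ε) (clebschDomain ω ε)
          (clebschD ω d4 d6 Δ6 Δ8 ε k) {x | clebschDelta ω Δ6 Δ8 ε x ≠ 0}) ∧
        -- the linear relation
        (∀ x, clebschDelta ω Δ6 Δ8 ε x ≠ 0 →
          (ω 1 - ω 2) * clebschD ω d4 d6 Δ6 Δ8 ε 0 x + (ω 2 - ω 0) * clebschD ω d4 d6 Δ6 Δ8 ε 1 x
            + (ω 0 - ω 1) * clebschD ω d4 d6 Δ6 Δ8 ε 2 x = 0) ∧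
        -- functional independence
        (∀ k l : Fin 3, k ≠ l → FunctionallyIndependent
          ![clebschD ω d4 d6 Δ6 Δ8 ε k, clebschD ω d4 d6 Δ6 Δ8 ε l]) ∧
        (∀ k l : Fin 3, k ≠ l → FunctionallyIndependent
          ![clebschD ω d4 d6 Δ6 Δ8 ε k, clebschD ω d4 d6 Δ6 Δ8 ε l, clebschJ ω ε]) := by
  refine ⟨num4Poly ω, num6Poly ω, den6Poly ω, den8Poly ω, isHomogeneous_num4 ω,
    isHomogeneous_num6 ω, isHomogeneous_den6 ω, isHomogeneous_den8 ω, fun ε hε =>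
    ⟨dense_clebschRegular ω ε, isHKBasis_clebschPsi hω hε,
      fun x hx hΔ => clebschD_mem_hkNullSpace hε hx hΔ,
      -- The first factor makes the d_k defined, the second bounds the dimension of the null-space
      -- by one.
      ⟨denPoly ω ε * minorPoly ω ε, mul_ne_zero (denPoly_ne_zero ω ε) (minorPoly_ne_zero hω hε),
        fun x hx hQ => ?_⟩,
      isIntegralOfMotion_clebschD hε, fun x hΔ => ?_, fun k l hkl => ?_,
      fun k l hkl => functionallyIndependent_clebschD_clebschJ hω hε hkl⟩⟩
  · rw [map_mul, eval_denPoly, ← clebschDelta_eq] at hQ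
    have hv := clebschD_mem_hkNullSpace hε hx (left_ne_zero_of_mul hQ)
    obtain ⟨hdim, hspan⟩ := hkNullSpace_eq_span hx (right_ne_zero_of_mul hQ) hv (by simp)
    exact ⟨left_ne_zero_of_mul hQ, hdim, hspan⟩
  · simp only [clebschD_eq]
    linear_combination pSq x / clebschDen ω ε x * clebschNum_linear_relation ω ε x
  · have h := (functionallyIndependent_clebschD_clebschJ hω hε hkl).comp
      (s := ![0, 1]) (by decide)
    convert h using 1
    ext i
    fin_cases i <;> rfl
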